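/- **Proposition 3.1 (Energy of an axisymmetric pattern).** Let $\gamma>0$, let $\mathbb S^2\subset\mathbb R^3$ be the unit sphere with surface measure $\mathcal H^2$, and for $u\in BV(\mathbb S^2;\{\pm1\})$ with $\frac1{4\pi}\int_{\mathbb S^2}u\,d\mathcal H^2=m$ let $$E_\gamma(u)=\frac12\int_{\mathbb S^2}|\nabla u|+\gamma\int_{\mathbb S^2}|\nabla v|^2\,d\mathcal H^2,$$ where $\int_{\mathbb S^2}|\nabla u|$ is the total variation of $u$ and $v\in H^1(\mathbb S^2)$ is any weak solution of $-\Delta v=u-m$ on $\mathbb S^2$. Let $m\in(-1,1)$, let $-1=z_0<z_1<\dots<z_n<z_{n+1}=1$, and let $u:\mathbb S^2\to\{\pm1\}$ be the axisymmetric pattern with interfaces $z_1,\dots,z_n$: $u(x)=(-1)^{k+1}$ if $z_k\le x_3<z_{k+1}$ for some $0\le k\le n$, and $u(x)=(-1)^{n+1}$ if $x_3=1$. Assume that $\frac1{4\pi}\int_{\mathbb S^2}u\,d\mathcal H^2=m$, and put $$\xi_k=\sum_{i=1}^k(-1)^i(z_i-z_{i-1})-m\sum_{i=1}^k(z_i-z_{i-1}),\qquad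 0\le k\le n .$$ Then $u\in BV(\mathbb S^2;\{\pm1\})$, the Poisson problem has a weak solution $v$, and for every such $v$ $$\begin{aligned}\frac1\pi E_\gamma(u)={}&-4\gamma(1-m^2)+2\sum_{k=1}^n\sqrt{1-z_k^2}\\&+\gamma\sum_{k=0}^n\bigl(\xi_k-((-1)^k+m)(1-z_k)\bigr)^2\log\frac{1-z_k}{1-z_{k+1}}\\&+\gamma\sum_{k=0}^n\bigl(\xi_k+((-1)^k+m)(1+z_k)\bigr)^2\log\frac{1+z_{k+1}}{1+z_k}.\end{aligned}$$ Here the term $k=n$ of the first logarithmic sum and the term $k=0$ of the second, whose logarithms are infinite, have prefactors equal to $0$, and these two terms are read as $0$. In particular, if $m=0$, then $$\begin{aligned}\frac1\pi E_\gamma(u)={}&-4\gamma+2\sum_{k=1}^n\sqrt{1-z_k^2}+\gamma\sum_{k=0}^n\bigl(\xi_k-(-1)^k(1-z_k)\bigr)^2\log\frac{1-z_k}{1-z_{k+1}}\\&+\gamma\sum_{k=0}^n\bigl(\xi_k+(-1)^k(1+z_k)\bigr)^2\log\frac{1+z_{k+1}}{1+z_k}.\end{aligned}$$ -/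

import Mathlib

open MeasureTheory Finset
open scoped ContDiff RealInnerProductSpace ENNReal

noncomputable section

/-- Euclidean three-space. -/
abbrev E3 : Type := EuclideanSpace ℝ (Fin 3)

/-- The unit two-sphere in Euclidean three-space. -/
abbrev S2 : Type := Metric.sphere (0 : E3) 1

/-- The surface measure of the unit sphere (total mass `4 π`). -/
def surfaceMeasure : Measure S2 := (volume : Measure E3).toSphere

/-- Smooth tangent vector fields on the sphere, written as restrictions of smooth maps of the
ambient space (every smooth tangent field on the sphere has such an extension). As the sphere is
compact, every field is compactly supported. -/
structure IsSmoothTangentField (X : E3 → E3) : Prop where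
  smooth : ContDiff ℝ ∞ X
  tangent : ∀ x : S2, ⟪X x, (x : E3)⟫ = 0

/-- Surface divergence of a vector field at a point `x` of the sphere: the trace of the derivative
over the tangent plane, that is the full trace minus the contribution of the unit normal `x`.
It depends only on the restriction of the field to the sphere. -/
def surfaceDiv (X : E3 → E3) (x : E3) : ℝ :=
  (∑ i : Fin 3, fderiv ℝ X x (EuclideanSpace.single i 1) i) - ⟪fderiv ℝ X x x, x⟫

/-- The total variation of `u` on the sphere: the supremum of `∫ u div X` over all smooth tangent
vector fields `X` with sup norm at most one. -/
def totalVariation (u : S2 → ℝ) : ℝ≥0∞ :=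
  ⨆ (X : E3 → E3) (_ : IsSmoothTangentField X) (_ : ∀ x : S2, ‖X x‖ ≤ 1),
    ENNReal.ofReal (∫ x : S2, u x * surfaceDiv X x ∂surfaceMeasure)

/-- The class `BV(S²; {±1})`. -/
structure MemBVSign (u : S2 → ℝ) : Prop where
  integrable : Integrable u surfaceMeasure
  finite_variation : totalVariation u < ⊤
  sign : ∀ᵐ x ∂surfaceMeasure, u x = 1 ∨ u x = -1

/-- `v` belongs to the Sobolev space `H¹(S²)` and `g` is its weak (surface) gradient. -/
structure HasWeakGradient (v : S2 → ℝ) (g : S2 → E3) : Prop where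
  memLp : MemLp v 2 surfaceMeasure
  memLp_grad : MemLp g 2 surfaceMeasure
  tangent : ∀ᵐ x ∂surfaceMeasure, ⟪g x, (x : E3)⟫ = 0
  integral_eq : ∀ X : E3 → E3, IsSmoothTangentField X →
    ∫ x : S2, v x * surfaceDiv X x ∂surfaceMeasure = - ∫ x : S2, ⟪g x, X x⟫ ∂surfaceMeasure

/-- `v`, with weak gradient `g`, is a weak solution in `H¹(S²)` of the Poisson problem
`-Δ v = u - m` on the sphere. -/
structure IsPoissonSolution (u : S2 → ℝ) (m : ℝ) (v : S2 → ℝ) (g : S2 → E3) : Prop where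
  grad : HasWeakGradient v g
  weak : ∀ (φ : S2 → ℝ) (h : S2 → E3), HasWeakGradient φ h →
    ∫ x : S2, ⟪g x, h x⟫ ∂surfaceMeasure = ∫ x : S2, (u x - m) * φ x ∂surfaceMeasure

/-- The energy `½ ∫ |∇u| + γ ∫ |∇v|²`, where `g` stands for the gradient of the solution `v` of the
Poisson problem with right-hand side `u - m`. -/
def energy (γ : ℝ) (u : S2 → ℝ) (g : S2 → E3) : ℝ :=
  1 / 2 * (totalVariation u).toReal + γ * ∫ x : S2, ‖g x‖ ^ 2 ∂surfaceMeasure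

/-- `u` is the axisymmetric pattern on the sphere with `n` interfaces at the heights
`-1 = z 0 < z 1 < ... < z n < z (n + 1) = 1`: it equals `(-1) ^ (k + 1)` where
the third coordinate lies in `[z k, z (k + 1))`, the last interval being closed. -/
structure IsAxisymmetricPattern (n : ℕ) (z : ℕ → ℝ) (u : S2 → ℝ) : Prop where
  first : z 0 = -1
  last : z (n + 1) = 1
  lt : ∀ k ≤ n, z k < z (k + 1)
  value : ∀ k ≤ n, ∀ x : S2, z k ≤ (x : E3) 2 → ((x : E3) 2 < z (k + 1) ∨ k = n) →
    u x = (-1) ^ (k + 1)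

/-- `ξ_k`, the value at `z k` of the primitive of `u - m` (in the variable `z`) vanishing
at `-1`. -/
def xi (m : ℝ) (z : ℕ → ℝ) (k : ℕ) : ℝ :=
  ∑ i ∈ Icc 1 k, (-1) ^ i * (z i - z (i - 1)) - m * ∑ i ∈ Icc 1 k, (z i - z (i - 1))

end

/-! Everything depends only on the height `s = x₃`, whose law under the surface measure is `2π ds`
on `(-1, 1)` (`map_height_surfaceMeasure`), so both terms of the energy reduce to one variable.

Perimeter. The integral of `surfaceDiv X` over a parallel, weighted by `cos a`, is the latitude
derivative of the flux of `X` across that parallel. As the flux vanishes at the poles, `∫ u div X =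
2 ∑ (-1)^k flux X (arcsin z_k)`. Each flux is at most the circumference `2π √(1 - z_k²)`, and a
single field `W(x₃)∇x₃` attains all these bounds with the right signs; hence `totalVariation_eq`.

Dirichlet term. With `f` the step function minus `m` and `F` its primitive from `-1`, the ansatz `v
= V(x₃)` turns the Poisson equation into `-((1 - s²)V')' = f`, so `V' = -F/(1 - s²)`. The mass
condition gives `F(1) = 0`, which keeps `V'` bounded at both poles. To test against an arbitrary
`H¹` function, `f` is approximated by polynomials of mean zero, for which the corresponding field is
smooth (`isPoissonSolution_poissonSlope`). All solutions have the same Dirichlet energy, so it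
equals `2π ∫ F²/(1 - s²)`. On each zone `F` is affine; partial fractions produce the two logarithms,
and the remaining constants telescope to `-4π(1 - m²)` (`integral_norm_heightField_sq`). -/

/-! ### Geographic coordinates and the surface measure. -/

/-- The point of Euclidean space of latitude `a` and longitude `t`. -/
noncomputable def spherePoint (a t : ℝ) : E3 :=
  !₂[Real.cos a * Real.cos t, Real.cos a * Real.sin t, Real.sin a]

lemma norm_spherePoint (a t : ℝ) : ‖spherePoint a t‖ = 1 := by
  rw [EuclideanSpace.norm_eq, Real.sqrt_eq_one]
  simp [spherePoint, Fin.sum_univ_three]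
  nlinarith [Real.sin_sq_add_cos_sq a, Real.sin_sq_add_cos_sq t,
    mul_self_nonneg (Real.cos a), congrArg (fun r => Real.cos a ^ 2 * r) (Real.sin_sq_add_cos_sq t)]

/-- The geographic parametrization of the sphere. -/
noncomputable def sphereParam (p : ℝ × ℝ) : S2 :=
  ⟨spherePoint p.1 p.2, by simp [norm_spherePoint]⟩

lemma continuous_spherePoint : Continuous fun p : ℝ × ℝ => spherePoint p.1 p.2 := by
  unfold spherePoint
  refine (PiLp.continuous_toLp 2 _).comp ?_
  refine continuous_pi fun i => ?_
  fin_cases i <;> simp <;> fun_prop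

lemma continuous_sphereParam : Continuous sphereParam :=
  continuous_spherePoint.subtype_mk _

/-- The measure `cos a da` on latitudes. -/
noncomputable def latitudeMeasure : Measure ℝ :=
  (volume.restrict (Set.Ioo (-(Real.pi / 2)) (Real.pi / 2))).withDensity
    fun a => ENNReal.ofReal (Real.cos a)

/-- The Lebesgue measure on longitudes. -/
noncomputable def longitudeMeasure : Measure ℝ := volume.restrict (Set.Ioo (-Real.pi) Real.pi)

lemma lintegral_E3 {f : E3 → ℝ≥0∞} (hf : Measurable f) :
    ∫⁻ x, f x = ∫⁻ s : ℝ, ∫⁻ p : ℝ × ℝ, f !₂[p.1, p.2, s] := by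
  have h1 := (PiLp.volume_preserving_toLp (Fin 3)).lintegral_comp hf
  have hf' : Measurable fun y : Fin 3 → ℝ => f (WithLp.toLp 2 y) :=
    hf.comp (PiLp.volume_preserving_toLp (Fin 3)).measurable
  have h2 := ((volume_preserving_piFinSuccAbove (fun _ : Fin 3 => ℝ) 2).symm).lintegral_comp hf'
  rw [← h1, ← h2, Measure.volume_eq_prod, lintegral_prod]
  · refine lintegral_congr fun s => ?_
    have hm : Measurable fun y : Fin 2 → ℝ => f (WithLp.toLp 2
        ((MeasurableEquiv.piFinSuccAbove (fun _ => ℝ) 2).symm (s, y))) :=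
      hf'.comp ((MeasurableEquiv.measurable _).comp measurable_prodMk_left)
    have h3 := ((volume_preserving_finTwoArrow ℝ).symm).lintegral_comp hm
    rw [← h3]
    refine lintegral_congr fun p => ?_
    congr 2
    funext i
    fin_cases i <;> rfl
  · exact (hf'.comp (MeasurableEquiv.measurable _)).aemeasurable

lemma measurable_vec3 {α : Type*} [MeasurableSpace α] {a b c : α → ℝ} (ha : Measurable a)
    (hb : Measurable b) (hc : Measurable c) : Measurable fun x => (!₂[a x, b x, c x] : E3) := by
  refine (PiLp.volume_preserving_toLp (Fin 3)).measurable.comp (measurable_pi_lambda _ fun i => ?_)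
  fin_cases i <;> simpa

/-- Planar polar coordinates are used twice: in the horizontal plane at fixed height, then in the
plane of horizontal radius and height. The indicator records that the horizontal radius is positive.
-/
lemma lintegral_E3_spherical {f : E3 → ℝ≥0∞} (hf : Measurable f) :
    ∫⁻ x, f x = ∫⁻ t in Set.Ioo (-Real.pi) Real.pi, ∫⁻ q in Set.Ioi (0 : ℝ) ×ˢ Set.Ioo (-Real.pi) Real.pi,
      ENNReal.ofReal q.1 * ((Set.Ioi (0 : ℝ)).indicator (fun r => ENNReal.ofReal r)
        (q.1 * Real.cos q.2) * f (q.1 • spherePoint q.2 t)) := by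
  rw [lintegral_E3 hf]
  have h1 : ∀ s : ℝ, ∫⁻ p : ℝ × ℝ, f !₂[p.1, p.2, s] =
      ∫⁻ t in Set.Ioo (-Real.pi) Real.pi, ∫⁻ r, (Set.Ioi (0 : ℝ)).indicator (fun r => ENNReal.ofReal r) r *
        f !₂[r * Real.cos t, r * Real.sin t, s] := by
    intro s
    rw [← lintegral_comp_polarCoord_symm, polarCoord_target, Measure.volume_eq_prod,
      setLIntegral_prod_symm]
    · refine lintegral_congr fun t => ?_
      rw [← lintegral_indicator measurableSet_Ioi]
      refine lintegral_congr fun r => ?_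
      by_cases hr : 0 < r <;> simp [Set.indicator, hr, polarCoord_symm_apply]
    · refine Measurable.aemeasurable ?_
      simp only [polarCoord_symm_apply, smul_eq_mul]
      refine Measurable.mul (by fun_prop) (hf.comp (measurable_vec3 ?_ ?_ ?_)) <;> fun_prop
  simp_rw [h1]
  have hind : Measurable ((Set.Ioi (0 : ℝ)).indicator (fun r => ENNReal.ofReal r)) :=
    (by fun_prop : Measurable fun r : ℝ => ENNReal.ofReal r).indicator measurableSet_Ioi
  have hJ : Measurable fun w : (ℝ × ℝ) × ℝ => (Set.Ioi (0 : ℝ)).indicator (fun r => ENNReal.ofReal r) w.2 *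
        f !₂[w.2 * Real.cos w.1.2, w.2 * Real.sin w.1.2, w.1.1] := by
    refine Measurable.mul (hind.comp measurable_snd) (hf.comp (measurable_vec3 ?_ ?_ ?_)) <;> fun_prop
  rw [lintegral_lintegral_swap]
  swap
  · exact (hJ.lintegral_prod_right (ν := volume)).aemeasurable
  refine lintegral_congr fun t => ?_
  rw [lintegral_lintegral_swap]
  swap
  · exact (hJ.comp (by fun_prop : Measurable fun w : ℝ × ℝ => ((w.1, t), w.2))).aemeasurable
  rw [lintegral_lintegral (f := fun r s => (Set.Ioi (0 : ℝ)).indicator (fun r => ENNReal.ofReal r) r *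
        f !₂[r * Real.cos t, r * Real.sin t, s])]
  swap
  · exact (hJ.comp (by fun_prop : Measurable fun w : ℝ × ℝ => ((w.2, t), w.1))).aemeasurable
  rw [← Measure.volume_eq_prod, ← lintegral_comp_polarCoord_symm, polarCoord_target]
  refine lintegral_congr fun q => ?_
  simp only [polarCoord_symm_apply, smul_eq_mul]
  congr 3
  ext i
  fin_cases i <;> simp [spherePoint] <;> ring

instance : IsFiniteMeasure surfaceMeasure := by
  unfold surfaceMeasure; infer_instance

instance : IsFiniteMeasure longitudeMeasure := by
  unfold longitudeMeasure; infer_instance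

lemma lintegral_latitudeMeasure {f : ℝ → ℝ≥0∞} (hf : Measurable f) :
    ∫⁻ a, f a ∂latitudeMeasure = ∫⁻ a in Set.Ioo (-(Real.pi / 2)) (Real.pi / 2),
      ENNReal.ofReal (Real.cos a) * f a := by
  rw [latitudeMeasure, lintegral_withDensity_eq_lintegral_mul _ (by fun_prop) hf]
  rfl

instance : IsFiniteMeasure latitudeMeasure := by
  refine ⟨?_⟩
  rw [← lintegral_one, lintegral_latitudeMeasure measurable_const]
  calc _ ≤ ∫⁻ a in Set.Ioo (-(Real.pi / 2)) (Real.pi / 2), (1 : ℝ≥0∞) := by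
        refine lintegral_mono fun a => ?_
        simpa using Real.cos_le_one a
    _ < ⊤ := by simp

-- `Measure.toSphere` is defined through the volume of the cone `Ioo 0 1 • s`; this describes the
-- cone along rays.
open scoped Pointwise in
lemma smul_mem_Ioo_smul_iff {s : Set S2} {r : ℝ} (hr : 0 < r) (x : S2) :
    r • (x : E3) ∈ Set.Ioo (0 : ℝ) 1 • ((↑) '' s : Set E3) ↔ r < 1 ∧ x ∈ s := by
  constructor
  · rintro ⟨q, ⟨hq0, hq1⟩, _, ⟨y, hy, rfl⟩, h⟩
    have hx : ‖(x : E3)‖ = 1 := norm_eq_of_mem_sphere x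
    have hy1 : ‖(y : E3)‖ = 1 := norm_eq_of_mem_sphere y
    have hn := congrArg norm h
    simp only [norm_smul, hx, hy1, Real.norm_eq_abs, abs_of_pos hr, abs_of_pos hq0, mul_one] at hn
    subst hn
    have : y = x := Subtype.ext (smul_right_injective E3 hr.ne' h)
    exact ⟨hq1, this ▸ hy⟩
  · rintro ⟨h1, hx⟩
    exact Set.smul_mem_smul ⟨hr, h1⟩ ⟨x, hx, rfl⟩

lemma cos_pos_iff_mem_Ioo {a : ℝ} (ha : a ∈ Set.Ioo (-Real.pi) Real.pi) :
    0 < Real.cos a ↔ a ∈ Set.Ioo (-(Real.pi / 2)) (Real.pi / 2) := by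
  constructor
  · intro h
    by_contra hn
    rw [Set.mem_Ioo, not_and_or, not_lt, not_lt] at hn
    rcases hn with hn | hn
    · have := Real.cos_nonpos_of_pi_div_two_le_of_le (x := -a) (by linarith)
        (by linarith [ha.1, Real.pi_pos])
      rw [Real.cos_neg] at this
      linarith
    · linarith [Real.cos_nonpos_of_pi_div_two_le_of_le hn (by linarith [ha.2, Real.pi_pos])]
  · exact fun h => Real.cos_pos_of_mem_Ioo h

lemma lintegral_sq_Ioo : ∫⁻ r in Set.Ioo (0 : ℝ) 1, ENNReal.ofReal (r ^ 2) = ENNReal.ofReal (1 / 3) := by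
  rw [← ofReal_integral_eq_lintegral_ofReal, ← integral_Ioc_eq_integral_Ioo,
    ← intervalIntegral.integral_of_le zero_le_one]
  · norm_num
  · exact ((by fun_prop : Continuous fun r : ℝ => r ^ 2).integrableOn_Icc (a := 0) (b := 1)).mono_set
      Set.Ioo_subset_Icc_self
  · exact Filter.Eventually.of_forall fun r => sq_nonneg r

-- The cone is the image of a Borel set under a continuous injective map, hence Borel by
-- Lusin–Souslin.
open scoped Pointwise in
lemma measurableSet_Ioo_smul {s : Set S2} (hs : MeasurableSet s) :
    MeasurableSet (Set.Ioo (0 : ℝ) 1 • ((↑) '' s : Set E3)) := by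
  have he : Set.Ioo (0 : ℝ) 1 • ((↑) '' s : Set E3) =
      (fun p : S2 × ℝ => p.2 • (p.1 : E3)) '' (s ×ˢ Set.Ioo 0 1) := by
    ext y
    constructor
    · rintro ⟨q, hq, _, ⟨y, hy, rfl⟩, rfl⟩
      exact ⟨(y, q), ⟨hy, hq⟩, rfl⟩
    · rintro ⟨⟨y, q⟩, ⟨hy, hq⟩, rfl⟩
      exact ⟨q, hq, _, ⟨y, hy, rfl⟩, rfl⟩
  rw [he]
  refine (hs.prod measurableSet_Ioo).image_of_continuousOn_injOn (by fun_prop) ?_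
  rintro ⟨x, r⟩ ⟨hx, hr⟩ ⟨y, q⟩ ⟨hy, hq⟩ hxy
  have hx : ‖(x : E3)‖ = 1 := norm_eq_of_mem_sphere x
  have hy1 : ‖(y : E3)‖ = 1 := norm_eq_of_mem_sphere y
  have hn := congrArg norm hxy
  simp only [norm_smul, hx, hy1, Real.norm_eq_abs, abs_of_pos hr.1, abs_of_pos hq.1, mul_one] at hn
  subst hn
  rw [Prod.mk.injEq]
  exact ⟨Subtype.ext (smul_right_injective E3 hr.1.ne' hxy), rfl⟩

-- The cone volume splits in spherical coordinates; the radial factor `∫ r² dr = 1/3` cancels the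
-- dimension `3` in `Measure.toSphere`.
open scoped Pointwise in
theorem surfaceMeasure_eq_map :
    surfaceMeasure = (latitudeMeasure.prod longitudeMeasure).map sphereParam := by
  ext s hs
  set A : Set E3 := Set.Ioo (0 : ℝ) 1 • ((↑) '' s : Set E3) with hA
  have hAm : MeasurableSet A := measurableSet_Ioo_smul hs
  have hsm : Measurable (s.indicator (1 : S2 → ℝ≥0∞)) := measurable_one.indicator hs
  have hk : Measurable fun p : ℝ × ℝ => s.indicator (1 : S2 → ℝ≥0∞) (sphereParam p) :=
    hsm.comp continuous_sphereParam.measurable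
  have hvol : volume A = ∫⁻ t in Set.Ioo (-Real.pi) Real.pi, ENNReal.ofReal (1 / 3) *
      ∫⁻ a, s.indicator 1 (sphereParam (a, t)) ∂latitudeMeasure := by
    rw [← lintegral_indicator_one hAm, lintegral_E3_spherical (measurable_one.indicator hAm)]
    refine lintegral_congr fun t => ?_
    have hkt : Measurable fun a : ℝ => s.indicator (1 : S2 → ℝ≥0∞) (sphereParam (a, t)) :=
      hk.comp measurable_prodMk_right
    rw [lintegral_latitudeMeasure hkt, ← lintegral_sq_Ioo,
      ← lintegral_prod_mul (by fun_prop) (by fun_prop), Measure.prod_restrict,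
      ← Measure.volume_eq_prod, ← lintegral_indicator (measurableSet_Ioi.prod measurableSet_Ioo),
      ← lintegral_indicator (measurableSet_Ioo.prod measurableSet_Ioo)]
    refine lintegral_congr fun q => ?_
    obtain ⟨r, a⟩ := q
    by_cases hr : 0 < r
    swap
    · simp [Set.indicator, hr]
    by_cases ha : a ∈ Set.Ioo (-Real.pi) Real.pi
    swap
    · have : a ∉ Set.Ioo (-(Real.pi / 2)) (Real.pi / 2) := fun h =>
        ha ⟨by linarith [h.1, Real.pi_pos], by linarith [h.2, Real.pi_pos]⟩
      rw [Set.indicator_of_notMem (by simp only [Set.mem_prod]; tauto),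
        Set.indicator_of_notMem (by simp only [Set.mem_prod]; tauto)]
    rw [Set.indicator_of_mem (by exact ⟨hr, ha⟩)]
    have hmem : r • spherePoint a t ∈ A ↔ r < 1 ∧ sphereParam (a, t) ∈ s :=
      smul_mem_Ioo_smul_iff hr (sphereParam (a, t))
    have hcos : 0 < r * Real.cos a ↔ a ∈ Set.Ioo (-(Real.pi / 2)) (Real.pi / 2) := by
      rw [mul_pos_iff_of_pos_left hr, cos_pos_iff_mem_Ioo ha]
    by_cases h1 : r < 1
    swap
    · simp [Set.indicator, hmem, h1]
    by_cases h2 : a ∈ Set.Ioo (-(Real.pi / 2)) (Real.pi / 2)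
    swap
    · rw [Set.indicator_of_notMem (s := Set.Ioi (0:ℝ)) (by simpa using not_lt.1 (hcos.not.2 h2)),
        Set.indicator_of_notMem (s := Set.Ioo (0 : ℝ) 1 ×ˢ _) (by exact fun h => h2 h.2)]
      simp
    rw [Set.indicator_of_mem (s := Set.Ioi (0:ℝ)) (by exact hcos.2 h2),
      Set.indicator_of_mem (s := Set.Ioo (0 : ℝ) 1 ×ˢ _) (by exact ⟨⟨hr, h1⟩, h2⟩)]
    by_cases h3 : sphereParam (a, t) ∈ s
    · simp only [Set.indicator, hmem, h1, h3, and_self, if_true, Pi.one_apply, mul_one]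
      rw [← ENNReal.ofReal_mul hr.le, ← ENNReal.ofReal_mul (by positivity)]
      ring_nf
    · simp [Set.indicator, hmem, h3]
  rw [surfaceMeasure, Measure.toSphere_apply' _ hs, ← hA, hvol,
    lintegral_const_mul' _ _ ENNReal.ofReal_ne_top, ← mul_assoc]
  have h3 : ((Module.finrank ℝ E3 : ℕ) : ℝ≥0∞) * ENNReal.ofReal (1 / 3) = 1 := by
    rw [finrank_euclideanSpace, Fintype.card_fin, ← ENNReal.ofReal_natCast, ← ENNReal.ofReal_mul (by simp)]
    norm_num
  rw [h3, one_mul, ← lintegral_indicator_one hs, lintegral_map hsm continuous_sphereParam.measurable,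
    lintegral_prod_symm _ hk.aemeasurable]
  rfl

lemma map_sin_latitudeMeasure :
    latitudeMeasure.map Real.sin = volume.restrict (Set.Ioo (-1) 1) := by
  ext s hs
  have hsm : Measurable (s.indicator (1 : ℝ → ℝ≥0∞)) := measurable_one.indicator hs
  have himg : Real.sin '' Set.Ioo (-(Real.pi / 2)) (Real.pi / 2) = Set.Ioo (-1) 1 := by
    have := Real.sinPartialHomeomorph.image_source_eq_target
    simpa using this
  rw [← lintegral_indicator_one hs, ← lintegral_indicator_one hs,
    lintegral_map hsm Real.measurable_sin, lintegral_latitudeMeasure (f := fun a => s.indicator 1 (Real.sin a)) (hsm.comp Real.measurable_sin),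
    ← himg, lintegral_image_eq_lintegral_abs_deriv_mul measurableSet_Ioo
      (fun x _ => (Real.hasDerivAt_sin x).hasDerivWithinAt)
      (Real.injOn_sin.mono Set.Ioo_subset_Icc_self)]
  refine setLIntegral_congr_fun measurableSet_Ioo fun a ha => ?_
  simp only [abs_of_pos (Real.cos_pos_of_mem_Ioo ha)]

/-- Archimedes' hat-box theorem: the density `cos a` is exactly the Jacobian of `sin`. -/
lemma map_height_surfaceMeasure :
    surfaceMeasure.map (fun x : S2 => (x : E3) 2) =
      ENNReal.ofReal (2 * Real.pi) • volume.restrict (Set.Ioo (-1) 1) := by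
  have h1 : (fun x : S2 => (x : E3) 2) ∘ sphereParam = Real.sin ∘ Prod.fst := by
    funext p; simp [sphereParam, spherePoint]
  rw [surfaceMeasure_eq_map, Measure.map_map (by fun_prop) continuous_sphereParam.measurable, h1,
    ← Measure.map_map Real.measurable_sin measurable_fst, Measure.map_fst_prod, Measure.map_smul,
    map_sin_latitudeMeasure]
  congr 1
  rw [longitudeMeasure, Measure.restrict_apply_univ, Real.volume_Ioo]
  congr 1
  ring

lemma integral_height {f : ℝ → ℝ} (hf : Measurable f) :
    ∫ x : S2, f ((x : E3) 2) ∂surfaceMeasure = 2 * Real.pi * ∫ s in (-1 : ℝ)..1, f s := by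
  rw [← integral_map (φ := fun x : S2 => (x : E3) 2) (by fun_prop) hf.aestronglyMeasurable,
    map_height_surfaceMeasure, integral_smul_measure, intervalIntegral.integral_of_le (by norm_num),
    integral_Ioc_eq_integral_Ioo, ENNReal.toReal_ofReal (by positivity), smul_eq_mul]

lemma integral_latitudeMeasure (f : ℝ → ℝ) :
    ∫ a, f a ∂latitudeMeasure = ∫ a in (-(Real.pi / 2))..(Real.pi / 2), Real.cos a * f a := by
  rw [latitudeMeasure, integral_withDensity_eq_integral_toReal_smul (by fun_prop) (by simp),
    intervalIntegral.integral_of_le (by linarith [Real.pi_pos]), integral_Ioc_eq_integral_Ioo]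
  refine setIntegral_congr_fun measurableSet_Ioo fun a ha => ?_
  simp [ENNReal.toReal_ofReal (Real.cos_pos_of_mem_Ioo ha).le]

/-- Integration over the sphere in geographic coordinates. -/
lemma integral_sphere {f : S2 → ℝ} (hf : Integrable f surfaceMeasure) :
    ∫ x, f x ∂surfaceMeasure = ∫ a in (-(Real.pi / 2))..(Real.pi / 2),
      Real.cos a * ∫ t in (-Real.pi)..Real.pi, f (sphereParam (a, t)) := by
  rw [surfaceMeasure_eq_map] at hf ⊢
  have hm := continuous_sphereParam.measurable.aemeasurable (μ := latitudeMeasure.prod longitudeMeasure)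
  rw [integral_map hm hf.aestronglyMeasurable, integral_prod, integral_latitudeMeasure]
  · simp_rw [longitudeMeasure, intervalIntegral.integral_of_le (by linarith [Real.pi_pos] :
      -Real.pi ≤ Real.pi), integral_Ioc_eq_integral_Ioo]
  · exact hf.comp_aemeasurable hm

/-! ### Surface divergence and flux across parallels. -/

/-- The unit vector tangent to the meridian of longitude `t`. -/
noncomputable def meridianTangent (a t : ℝ) : E3 :=
  !₂[-Real.sin a * Real.cos t, -Real.sin a * Real.sin t, Real.cos a]

/-- The unit vector tangent to the parallels at longitude `t`. -/
noncomputable def parallelTangent (t : ℝ) : E3 := !₂[-Real.sin t, Real.cos t, 0]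

lemma hasDerivAt_vec3 {a b c : ℝ → ℝ} {a' b' c' x : ℝ} (ha : HasDerivAt a a' x)
    (hb : HasDerivAt b b' x) (hc : HasDerivAt c c' x) :
    HasDerivAt (fun x => (!₂[a x, b x, c x] : E3)) !₂[a', b', c'] x := by
  have h : HasDerivAt (fun x => ![a x, b x, c x]) ![a', b', c'] x := by
    rw [hasDerivAt_pi]
    intro i
    fin_cases i
    exacts [ha, hb, hc]
  exact (PiLp.hasFDerivAt_toLp (𝕜 := ℝ) 2 ![a x, b x, c x]).comp_hasDerivAt x h

lemma hasDerivAt_coord {f : ℝ → E3} {f' : E3} {x : ℝ} (h : HasDerivAt f f' x) (i : Fin 3) :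
    HasDerivAt (fun x => f x i) (f' i) x := by
  have h2 : HasFDerivAt (EuclideanSpace.proj i : E3 →L[ℝ] ℝ) _ (f x) :=
    (EuclideanSpace.proj i : E3 →L[ℝ] ℝ).hasFDerivAt
  exact h2.comp_hasDerivAt x h

lemma hasDerivAt_spherePoint_left (a t : ℝ) :
    HasDerivAt (fun a => spherePoint a t) (meridianTangent a t) a :=
  hasDerivAt_vec3 ((Real.hasDerivAt_cos a).mul_const _) ((Real.hasDerivAt_cos a).mul_const _)
    (Real.hasDerivAt_sin a)

lemma hasDerivAt_spherePoint_right (a t : ℝ) :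
    HasDerivAt (fun t => spherePoint a t) (Real.cos a • parallelTangent t) t := by
  have h := hasDerivAt_vec3 ((Real.hasDerivAt_cos t).const_mul (Real.cos a))
    ((Real.hasDerivAt_sin t).const_mul (Real.cos a)) (hasDerivAt_const t (Real.sin a))
  refine h.congr_deriv ?_
  ext i
  fin_cases i <;> simp [parallelTangent]

lemma hasDerivAt_parallelTangent (t : ℝ) :
    HasDerivAt parallelTangent (-!₂[Real.cos t, Real.sin t, 0]) t := by
  have h := hasDerivAt_vec3 (Real.hasDerivAt_sin t).neg (Real.hasDerivAt_cos t)
    (hasDerivAt_const t (0 : ℝ))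
  refine h.congr_deriv ?_
  ext i
  fin_cases i <;> simp

lemma continuous_meridianTangent : Continuous fun p : ℝ × ℝ => meridianTangent p.1 p.2 := by
  unfold meridianTangent
  refine (PiLp.continuous_toLp 2 _).comp (continuous_pi fun i => ?_)
  fin_cases i <;> simp <;> fun_prop

lemma continuous_parallelTangent : Continuous parallelTangent :=
  continuous_iff_continuousAt.2 fun t => (hasDerivAt_parallelTangent t).continuousAt

lemma inner_E3 (x y : E3) : ⟪x, y⟫ = x 0 * y 0 + x 1 * y 1 + x 2 * y 2 := by
  simp [PiLp.inner_apply, Fin.sum_univ_three]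
  ring

lemma map_E3_apply (D : E3 →L[ℝ] E3) (v : E3) (i : Fin 3) :
    D v i = v 0 * D (EuclideanSpace.single 0 1) i + v 1 * D (EuclideanSpace.single 1 1) i +
      v 2 * D (EuclideanSpace.single 2 1) i := by
  have hv : v = v 0 • EuclideanSpace.single 0 1 + v 1 • EuclideanSpace.single 1 1 +
      v 2 • EuclideanSpace.single 2 1 := by
    ext i
    fin_cases i <;> simp
  conv_lhs => rw [hv]
  simp

namespace IsSmoothTangentField

variable {X : E3 → E3}

lemma hasFDerivAt (hX : IsSmoothTangentField X) (x : E3) : HasFDerivAt X (fderiv ℝ X x) x :=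
  (hX.smooth.differentiable (by simp) x).hasFDerivAt

lemma continuous_fderiv (hX : IsSmoothTangentField X) : Continuous (fderiv ℝ X) :=
  hX.smooth.continuous_fderiv (by simp)

lemma inner_spherePoint (hX : IsSmoothTangentField X) (a t : ℝ) :
    ⟪X (spherePoint a t), spherePoint a t⟫ = 0 :=
  hX.tangent (sphereParam (a, t))

/-- The surface divergence in geographic coordinates. -/
lemma cos_mul_surfaceDiv (hX : IsSmoothTangentField X) (a t : ℝ) :
    Real.cos a * surfaceDiv X (spherePoint a t) =
      fderiv ℝ X (spherePoint a t) (meridianTangent a t) 2 +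
      (⟪X (spherePoint a t), -!₂[Real.cos t, Real.sin t, 0]⟫ +
        ⟪fderiv ℝ X (spherePoint a t) (Real.cos a • parallelTangent t), parallelTangent t⟫) := by
  -- Tangency differentiated along the meridian. The vertical unit vector is `cos a` times the
  -- meridian tangent plus `sin a` times the normal, so the third component of the meridian
  -- derivative carries an extra normal part; by `hT` that part cancels against the term containing
  -- `-!₂[cos t, sin t, 0]`.
  have hT : ⟪X (spherePoint a t), meridianTangent a t⟫ +
      ⟪fderiv ℝ X (spherePoint a t) (meridianTangent a t), spherePoint a t⟫ = 0 := by
    have h1 := ((hX.hasFDerivAt (spherePoint a t)).comp_hasDerivAt a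
      (hasDerivAt_spherePoint_left a t)).inner ℝ (hasDerivAt_spherePoint_left a t)
    have h2 : (fun a => ⟪(X ∘ fun a => spherePoint a t) a, spherePoint a t⟫) = fun _ => 0 :=
      funext fun a => hX.inner_spherePoint a t
    rw [h2] at h1
    exact h1.unique (hasDerivAt_const a (0 : ℝ))
  have hN := hX.inner_spherePoint a t
  rw [surfaceDiv, Fin.sum_univ_three]
  set D := fderiv ℝ X (spherePoint a t)
  simp only [inner_E3, map_E3_apply D (spherePoint a t), map_E3_apply D (meridianTangent a t),
    map_E3_apply D (Real.cos a • parallelTangent t)] at hT hN ⊢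
  simp only [spherePoint, meridianTangent, parallelTangent, PiLp.toLp_apply, PiLp.neg_apply, PiLp.smul_apply, smul_eq_mul,
    Matrix.cons_val_zero, Matrix.cons_val_one, Matrix.cons_val] at hT hN ⊢
  have h1 := Real.sin_sq_add_cos_sq a
  have h2 := Real.sin_sq_add_cos_sq t
  set c := Real.cos a
  set s := Real.sin a
  set C := Real.cos t
  set S := Real.sin t
  set X0 := X !₂[c * C, c * S, s] 0
  set X1 := X !₂[c * C, c * S, s] 1
  set X2 := X !₂[c * C, c * S, s] 2
  set d00 := D (EuclideanSpace.single 0 1) 0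
  set d01 := D (EuclideanSpace.single 1 1) 0
  set d02 := D (EuclideanSpace.single 2 1) 0
  set d10 := D (EuclideanSpace.single 0 1) 1
  set d11 := D (EuclideanSpace.single 1 1) 1
  set d12 := D (EuclideanSpace.single 2 1) 1
  set d20 := D (EuclideanSpace.single 0 1) 2
  set d21 := D (EuclideanSpace.single 1 1) 2
  set d22 := D (EuclideanSpace.single 2 1) 2
  -- Entries of the completeness relation for the orthonormal frame made of the normal, the parallel
  -- tangent and the meridian tangent.
  have h00 : (c * C) * (c * C) + S * S + (s * C) * (s * C) = 1 := by
    linear_combination C ^ 2 * h1 + h2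
  have h01 : (c * C) * (c * S) - S * C + (s * C) * (s * S) = 0 := by
    linear_combination C * S * h1
  have h11 : (c * S) * (c * S) + C * C + (s * S) * (s * S) = 1 := by
    linear_combination S ^ 2 * h1 + h2
  linear_combination (-c) * (d00 * h00 + (d01 + d10) * h01 + d11 * h11 + d22 * h1) +
    (d20 * (-s * C) + d21 * (-s * S) + d22 * c) * h1 - s * hT + c * hN - (X0 * C + X1 * S) * h1

end IsSmoothTangentField

lemma continuous_surfaceDiv {X : E3 → E3} (hX : IsSmoothTangentField X) :
    Continuous (surfaceDiv X) := by
  have h := hX.continuous_fderiv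
  unfold surfaceDiv
  fun_prop

/-- The flux of a tangent field across the parallel of latitude `a`, in the direction of the
north pole. -/
noncomputable def flux (X : E3 → E3) (a : ℝ) : ℝ :=
  ∫ t in (-Real.pi)..Real.pi, X (spherePoint a t) 2

/-- The derivative of `flux X` in the latitude. -/
noncomputable def fluxDeriv (X : E3 → E3) (a : ℝ) : ℝ :=
  ∫ t in (-Real.pi)..Real.pi, fderiv ℝ X (spherePoint a t) (meridianTangent a t) 2

lemma hasDerivAt_parametric_integral {f f' : ℝ → ℝ → ℝ} {b c : ℝ}
    (hf : Continuous (Function.uncurry f)) (hf' : Continuous (Function.uncurry f'))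
    (h : ∀ a t, HasDerivAt (fun a => f a t) (f' a t) a) (a : ℝ) :
    HasDerivAt (fun a => ∫ t in b..c, f a t) (∫ t in b..c, f' a t) a := by
  obtain ⟨K, hK⟩ := ((isCompact_closedBall a 1).prod (isCompact_uIcc (a := b) (b := c))).exists_bound_of_continuousOn
    hf'.continuousOn
  refine (intervalIntegral.hasDerivAt_integral_of_dominated_loc_of_deriv_le (bound := fun _ => K)
    (Metric.closedBall_mem_nhds a one_pos) ?_ ?_ ?_ ?_ ?_ ?_).2
  · exact Filter.Eventually.of_forall fun x => (by fun_prop : Continuous (f x)).aestronglyMeasurable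
  · exact (by fun_prop : Continuous (f a)).intervalIntegrable _ _
  · exact (by fun_prop : Continuous (f' a)).aestronglyMeasurable
  · exact Filter.Eventually.of_forall fun t ht x hx =>
      hK (x, t) ⟨hx, Set.uIoc_subset_uIcc ht⟩
  · simp
  · exact Filter.Eventually.of_forall fun t _ x _ => h x t

section
variable {X : E3 → E3}

lemma continuous_comp_spherePoint (hX : IsSmoothTangentField X) :
    Continuous fun p : ℝ × ℝ => X (spherePoint p.1 p.2) :=
  hX.smooth.continuous.comp continuous_spherePoint

lemma continuous_fderiv_meridianTangent (hX : IsSmoothTangentField X) :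
    Continuous (Function.uncurry fun a t =>
      fderiv ℝ X (spherePoint a t) (meridianTangent a t) 2) := by
  have h1 := hX.continuous_fderiv.comp continuous_spherePoint
  have h2 := h1.clm_apply continuous_meridianTangent
  exact (by fun_prop : Continuous fun x : E3 => x 2).comp h2

lemma hasDerivAt_flux (hX : IsSmoothTangentField X) (a : ℝ) :
    HasDerivAt (flux X) (fluxDeriv X a) a := by
  have h1 : Continuous (Function.uncurry fun a t => X (spherePoint a t) 2) :=
    (by fun_prop : Continuous fun x : E3 => x 2).comp (continuous_comp_spherePoint hX)
  refine hasDerivAt_parametric_integral h1 (continuous_fderiv_meridianTangent hX) ?_ a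
  intro a t
  have h1 : HasDerivAt (fun a => X (spherePoint a t))
      (fderiv ℝ X (spherePoint a t) (meridianTangent a t)) a :=
    (hX.hasFDerivAt (spherePoint a t)).comp_hasDerivAt a (hasDerivAt_spherePoint_left a t)
  have h2 := hasDerivAt_coord h1 2
  exact h2

lemma continuous_fluxDeriv (hX : IsSmoothTangentField X) : Continuous (fluxDeriv X) := by
  exact intervalIntegral.continuous_parametric_intervalIntegral_of_continuous'
    (continuous_fderiv_meridianTangent hX) _ _

lemma continuous_flux (hX : IsSmoothTangentField X) : Continuous (flux X) :=
  continuous_iff_continuousAt.2 fun a => (hasDerivAt_flux hX a).continuousAt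

/-- The longitudinal part of the divergence is the derivative in `t` of `⟪X, parallelTangent t⟫`,
which is `2π`-periodic and so integrates to zero. -/
lemma integral_cos_mul_surfaceDiv (hX : IsSmoothTangentField X) (a : ℝ) :
    Real.cos a * ∫ t in (-Real.pi)..Real.pi, surfaceDiv X (spherePoint a t) = fluxDeriv X a := by
  have hc1 : Continuous fun t => fderiv ℝ X (spherePoint a t) (meridianTangent a t) 2 :=
    (continuous_fderiv_meridianTangent hX).uncurry_left a
  have hsp : Continuous fun t => spherePoint a t :=
    continuous_spherePoint.comp (by fun_prop : Continuous fun t : ℝ => (a, t))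
  have hX1 : Continuous fun t => X (spherePoint a t) := hX.smooth.continuous.comp hsp
  have hτ := continuous_parallelTangent
  have hD : Continuous fun t => fderiv ℝ X (spherePoint a t) (Real.cos a • parallelTangent t) :=
    (hX.continuous_fderiv.comp hsp).clm_apply (by fun_prop)
  have hρ : Continuous fun t : ℝ => -(!₂[Real.cos t, Real.sin t, 0] : E3) := by
    refine ((PiLp.continuous_toLp 2 _).comp (continuous_pi fun i => ?_)).neg
    fin_cases i <;> simp <;> fun_prop
  have hc2 : Continuous fun t => ⟪X (spherePoint a t), -!₂[Real.cos t, Real.sin t, 0]⟫ +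
        ⟪fderiv ℝ X (spherePoint a t) (Real.cos a • parallelTangent t), parallelTangent t⟫ :=
    (hX1.inner hρ).add (hD.inner hτ)
  rw [← intervalIntegral.integral_const_mul]
  simp_rw [hX.cos_mul_surfaceDiv]
  rw [intervalIntegral.integral_add (hc1.intervalIntegrable _ _) (hc2.intervalIntegrable _ _),
    intervalIntegral.integral_eq_sub_of_hasDerivAt
      (f := fun t => ⟪X (spherePoint a t), parallelTangent t⟫) _ (hc2.intervalIntegrable _ _)]
  · simp [spherePoint, parallelTangent, fluxDeriv]
  · intro t _
    exact ((hX.hasFDerivAt (spherePoint a t)).comp_hasDerivAt t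
      (hasDerivAt_spherePoint_right a t)).inner ℝ (hasDerivAt_parallelTangent t)

lemma integrable_height_mul {w : ℝ → ℝ} (hw : Measurable w) {K : ℝ}
    (hK : ∀ s ∈ Set.Icc (-1 : ℝ) 1, |w s| ≤ K) {f : S2 → ℝ} (hf : Integrable f surfaceMeasure) :
    Integrable (fun x : S2 => w ((x : E3) 2) * f x) surfaceMeasure := by
  refine hf.bdd_mul (c := K) (hw.comp (by fun_prop)).aestronglyMeasurable ?_
  refine Filter.Eventually.of_forall fun x => hK _ (abs_le.1 ?_)
  have := PiLp.norm_apply_le (x : E3) 2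
  rwa [norm_eq_of_mem_sphere x] at this

lemma integrable_of_continuous {f : S2 → ℝ} (hf : Continuous f) : Integrable f surfaceMeasure :=
  hf.integrable_of_hasCompactSupport (HasCompactSupport.of_compactSpace f)

lemma integral_height_mul_surfaceDiv (hX : IsSmoothTangentField X) {w : ℝ → ℝ}
    (hw : Measurable w) {K : ℝ} (hK : ∀ s ∈ Set.Icc (-1 : ℝ) 1, |w s| ≤ K) :
    ∫ x : S2, w ((x : E3) 2) * surfaceDiv X x ∂surfaceMeasure =
      ∫ a in (-(Real.pi / 2))..(Real.pi / 2), w (Real.sin a) * fluxDeriv X a := by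
  rw [integral_sphere (f := fun x : S2 => w ((x : E3) 2) * surfaceDiv X x)
    (integrable_height_mul hw hK (integrable_of_continuous
      ((continuous_surfaceDiv hX).comp continuous_subtype_val)))]
  refine intervalIntegral.integral_congr fun a _ => ?_
  have : ∀ t, w ((sphereParam (a, t) : E3) 2) * surfaceDiv X (sphereParam (a, t)) =
      w (Real.sin a) * surfaceDiv X (spherePoint a t) := fun t => by
    simp [sphereParam, spherePoint]
  simp only [this]
  rw [intervalIntegral.integral_const_mul, ← integral_cos_mul_surfaceDiv hX]
  ring

lemma integral_height_mul_coord (hX : IsSmoothTangentField X) {w : ℝ → ℝ}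
    (hw : Measurable w) {K : ℝ} (hK : ∀ s ∈ Set.Icc (-1 : ℝ) 1, |w s| ≤ K) :
    ∫ x : S2, w ((x : E3) 2) * X x 2 ∂surfaceMeasure =
      ∫ a in (-(Real.pi / 2))..(Real.pi / 2), Real.cos a * w (Real.sin a) * flux X a := by
  have hc := hX.smooth.continuous
  rw [integral_sphere (integrable_height_mul hw hK (integrable_of_continuous
    (by fun_prop)))]
  refine intervalIntegral.integral_congr fun a _ => ?_
  have : ∀ t, w ((sphereParam (a, t) : E3) 2) * X (sphereParam (a, t)) 2 =
      w (Real.sin a) * X (spherePoint a t) 2 := fun t => by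
    simp [sphereParam, spherePoint]
  simp only [this]
  rw [intervalIntegral.integral_const_mul, flux]
  ring

/-- At a pole the tangent plane is horizontal, so the vertical component of `X` vanishes. -/
lemma flux_pole (hX : IsSmoothTangentField X) {a : ℝ} (ha : Real.cos a = 0) : flux X a = 0 := by
  have : ∀ t, X (spherePoint a t) 2 = 0 := by
    intro t
    have h := hX.inner_spherePoint a t
    rw [inner_E3] at h
    have hs : Real.sin a ≠ 0 := fun h0 => by
      have := Real.sin_sq_add_cos_sq a
      rw [h0, ha] at this
      norm_num at this
    simpa [spherePoint, ha, hs] using h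
  simp [flux, this]

/-- Only the tangential part of the vertical unit vector pairs with `y`, and its length is `√(1 -
x₃²)`. -/
lemma abs_coord_le_of_inner_eq_zero {x y : E3} (hx : ‖x‖ = 1) (hxy : ⟪y, x⟫ = 0) :
    |y 2| ≤ ‖y‖ * √(1 - x 2 ^ 2) := by
  have h1 : y 2 = ⟪y, EuclideanSpace.single 2 1 - x 2 • x⟫ := by
    rw [inner_sub_right, inner_smul_right, hxy]
    simp [inner_E3]
  have h2 : ‖(EuclideanSpace.single 2 1 : E3) - x 2 • x‖ = √(1 - x 2 ^ 2) := by
    rw [← Real.sqrt_sq (norm_nonneg _), norm_sub_sq_real]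
    congr 1
    simp [inner_smul_right, norm_smul, hx, inner_E3]
    ring
  rw [h1, ← h2]
  exact abs_real_inner_le_norm _ _

lemma abs_flux_le (hX : IsSmoothTangentField X) (h1 : ∀ x : S2, ‖X x‖ ≤ 1) (a : ℝ) :
    |flux X a| ≤ 2 * Real.pi * √(1 - Real.sin a ^ 2) := by
  have := intervalIntegral.norm_integral_le_of_norm_le_const (a := -Real.pi) (b := Real.pi)
    (f := fun t => X (spherePoint a t) 2) (C := √(1 - Real.sin a ^ 2)) fun t _ => by
      have h := abs_coord_le_of_inner_eq_zero (norm_spherePoint a t) (hX.inner_spherePoint a t)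
      refine h.trans ?_
      have h2 : spherePoint a t 2 = Real.sin a := by simp [spherePoint]
      rw [h2]
      exact mul_le_of_le_one_left (Real.sqrt_nonneg _) (h1 (sphereParam (a, t)))
  rw [sub_neg_eq_add, abs_of_pos (by linarith [Real.pi_pos])] at this
  rw [flux]
  refine this.trans (le_of_eq ?_)
  ring

end

/-! ### The pattern as a step function of the height. -/

/-- The step function of the height which jumps by `2 * (-1) ^ (k + 1)` at `z k`, starting
from `-1`. -/
noncomputable def stepFn (n : ℕ) (z : ℕ → ℝ) (s : ℝ) : ℝ :=
  -1 + 2 * ∑ k ∈ Icc 1 n, (-1) ^ (k + 1) * (Set.Ici (z k)).indicator 1 s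

lemma measurable_stepFn (n : ℕ) (z : ℕ → ℝ) : Measurable (stepFn n z) := by
  unfold stepFn
  refine (Measurable.const_mul ?_ _).const_add _
  exact Finset.measurable_sum _ fun k _ =>
    (measurable_one.indicator measurableSet_Ici).const_mul _

lemma two_mul_sum_alternating (k : ℕ) :
    -1 + 2 * ∑ i ∈ Icc 1 k, (-1 : ℝ) ^ (i + 1) = (-1) ^ (k + 1) := by
  induction k with
  | zero => simp
  | succ k ih =>
    rw [Finset.sum_Icc_succ_top (by omega), mul_add, ← add_assoc, ih]
    ring

namespace IsAxisymmetricPattern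

variable {n : ℕ} {z : ℕ → ℝ} {u : S2 → ℝ}

lemma strictMono_of_le (hu : IsAxisymmetricPattern n z u) {i j : ℕ} (hij : i < j) (hj : j ≤ n + 1) :
    z i < z j := by
  induction j, hij using Nat.le_induction with
  | base => exact hu.lt i (by omega)
  | succ j hij ih => exact (ih (by omega)).trans (hu.lt j (by omega))

lemma mono_of_le (hu : IsAxisymmetricPattern n z u) {i j : ℕ} (hij : i ≤ j) (hj : j ≤ n + 1) :
    z i ≤ z j := by
  rcases hij.eq_or_lt with rfl | h
  · exact le_rfl
  · exact (hu.strictMono_of_le h hj).le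

lemma mem_Icc (hu : IsAxisymmetricPattern n z u) {k : ℕ} (hk : k ≤ n + 1) :
    z k ∈ Set.Icc (-1 : ℝ) 1 :=
  ⟨hu.first ▸ hu.mono_of_le (Nat.zero_le k) hk, hu.last ▸ hu.mono_of_le hk le_rfl⟩

lemma neg_one_lt (hu : IsAxisymmetricPattern n z u) {k : ℕ} (h1 : 1 ≤ k) (hk : k ≤ n + 1) :
    -1 < z k :=
  hu.first ▸ hu.strictMono_of_le h1 hk

lemma lt_one (hu : IsAxisymmetricPattern n z u) {k : ℕ} (hk : k ≤ n) : z k < 1 :=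
  hu.last ▸ hu.strictMono_of_le (Nat.lt_succ_of_le hk) le_rfl

lemma exists_mem (hu : IsAxisymmetricPattern n z u) {s : ℝ} (hs : -1 ≤ s) :
    ∃ k ≤ n, z k ≤ s ∧ (s < z (k + 1) ∨ k = n) := by
  classical
  obtain ⟨k, ⟨hk, hks⟩, hmax⟩ : ∃ k, (k ≤ n ∧ z k ≤ s) ∧ ∀ j, j ≤ n → z j ≤ s → j ≤ k := by
    have h0 : (Finset.filter (fun k => z k ≤ s) (range (n + 1))).Nonempty :=
      ⟨0, by simp [hu.first, hs]⟩
    have h1 := Finset.max'_mem _ h0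
    simp only [Finset.mem_filter, Finset.mem_range] at h1
    refine ⟨Finset.max' _ h0, ⟨by omega, h1.2⟩, fun j hj hjs => Finset.le_max' _ j ?_⟩
    exact Finset.mem_filter.2 ⟨Finset.mem_range.2 (by omega), hjs⟩
  refine ⟨k, hk, hks, ?_⟩
  by_contra! h
  have := hmax (k + 1) (by omega) h.1
  omega

lemma stepFn_eq (hu : IsAxisymmetricPattern n z u) {k : ℕ} (hk : k ≤ n) {s : ℝ} (h1 : z k ≤ s)
    (h2 : s < z (k + 1) ∨ k = n) : stepFn n z s = (-1) ^ (k + 1) := by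
  rw [← two_mul_sum_alternating, stepFn]
  congr 2
  refine (Finset.sum_subset_zero_on_sdiff (Finset.Icc_subset_Icc_right hk) ?_ ?_).symm
  · intro j hj
    simp only [mem_sdiff, Finset.mem_Icc, not_and, not_le] at hj
    have hkj := hj.2 hj.1.1
    rcases h2 with h2 | h2
    · rw [Set.indicator_of_notMem, mul_zero]
      simp only [Set.mem_Ici, not_le]
      exact h2.trans_le (hu.mono_of_le hkj (by omega))
    · omega
  · intro j hj
    rw [Finset.mem_Icc] at hj
    rw [Set.indicator_of_mem, Pi.one_apply, mul_one]
    exact (hu.mono_of_le hj.2 (by omega)).trans h1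

lemma eq_stepFn (hu : IsAxisymmetricPattern n z u) (x : S2) : u x = stepFn n z ((x : E3) 2) := by
  have hx : |(x : E3) 2| ≤ 1 := by
    have := PiLp.norm_apply_le (x : E3) 2
    rwa [norm_eq_of_mem_sphere x] at this
  obtain ⟨k, hk, h1, h2⟩ := hu.exists_mem (abs_le.1 hx).1
  rw [hu.stepFn_eq hk h1 h2, hu.value k hk x h1 h2]

lemma abs_stepFn (hu : IsAxisymmetricPattern n z u) {s : ℝ} (hs : -1 ≤ s) :
    |stepFn n z s| = 1 := by
  obtain ⟨k, hk, h1, h2⟩ := hu.exists_mem hs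
  rw [hu.stepFn_eq hk h1 h2, abs_pow]
  simp

lemma measurable (hu : IsAxisymmetricPattern n z u) : Measurable u := by
  rw [funext hu.eq_stepFn]
  exact (measurable_stepFn n z).comp (by fun_prop)

lemma integrable (hu : IsAxisymmetricPattern n z u) : Integrable u surfaceMeasure := by
  have h := integrable_height_mul (measurable_stepFn n z) (K := 1)
    (fun s hs => (hu.abs_stepFn hs.1).le) (integrable_const (1 : ℝ))
  simpa [← hu.eq_stepFn] using h

end IsAxisymmetricPattern

/-! ### Total variation of the pattern. -/

/-- Divergence theorem on the polar cap above height `s`: the north pole contributes no flux. -/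
lemma integral_indicator_mul_fluxDeriv {X : E3 → E3} (hX : IsSmoothTangentField X) {s : ℝ}
    (hs : s ∈ Set.Ioo (-1 : ℝ) 1) :
    ∫ a in (-(Real.pi / 2))..(Real.pi / 2), (Set.Ici s).indicator 1 (Real.sin a) * fluxDeriv X a =
      -flux X (Real.arcsin s) := by
  have hb1 : -(Real.pi / 2) < Real.arcsin s := Real.neg_pi_div_two_lt_arcsin.2 hs.1
  have hb2 := Real.arcsin_le_pi_div_two s
  have h1 : ∫ a in (-(Real.pi / 2))..(Real.pi / 2),
      (Set.Ici s).indicator 1 (Real.sin a) * fluxDeriv X a =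
      ∫ a in Set.Ioc (-(Real.pi / 2)) (Real.pi / 2),
        (Set.Ici (Real.arcsin s)).indicator (fluxDeriv X) a := by
    rw [intervalIntegral.integral_of_le (by linarith [Real.pi_pos])]
    refine setIntegral_congr_fun measurableSet_Ioc fun a ha => ?_
    have := Real.arcsin_le_iff_le_sin (x := s) (y := a) ⟨hs.1.le, hs.2.le⟩ ⟨ha.1.le, ha.2⟩
    simp [Set.indicator, this]
  have h2 : Set.Ioc (-(Real.pi / 2)) (Real.pi / 2) ∩ Set.Ici (Real.arcsin s) =
      Set.Icc (Real.arcsin s) (Real.pi / 2) := by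
    ext a
    simp only [Set.mem_inter_iff, Set.mem_Ioc, Set.mem_Ici, Set.mem_Icc]
    constructor
    · rintro ⟨⟨_, h⟩, h'⟩; exact ⟨h', h⟩
    · rintro ⟨h', h⟩; exact ⟨⟨by linarith, h⟩, h'⟩
  rw [h1, setIntegral_indicator measurableSet_Ici, h2, integral_Icc_eq_integral_Ioc,
    ← intervalIntegral.integral_of_le hb2, intervalIntegral.integral_eq_sub_of_hasDerivAt
      (fun a _ => hasDerivAt_flux hX a) ((continuous_fluxDeriv hX).intervalIntegrable _ _),
    flux_pole hX Real.cos_pi_div_two, zero_sub]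

lemma integral_fluxDeriv {X : E3 → E3} (hX : IsSmoothTangentField X) :
    ∫ a in (-(Real.pi / 2))..(Real.pi / 2), fluxDeriv X a = 0 := by
  rw [intervalIntegral.integral_eq_sub_of_hasDerivAt
      (fun a _ => hasDerivAt_flux hX a) ((continuous_fluxDeriv hX).intervalIntegrable _ _),
    flux_pole hX Real.cos_pi_div_two, flux_pole hX (by simp), sub_zero]

/-- The constant part of `stepFn` contributes nothing; each jump `2(-1)^(k+1)` meets the minus sign
of the flux entering a cap. -/
lemma IsAxisymmetricPattern.integral_mul_surfaceDiv {n : ℕ} {z : ℕ → ℝ} {u : S2 → ℝ}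
    (hu : IsAxisymmetricPattern n z u) {X : E3 → E3} (hX : IsSmoothTangentField X) :
    ∫ x : S2, u x * surfaceDiv X x ∂surfaceMeasure =
      2 * ∑ k ∈ Icc 1 n, (-1) ^ k * flux X (Real.arcsin (z k)) := by
  simp_rw [hu.eq_stepFn]
  rw [integral_height_mul_surfaceDiv hX (measurable_stepFn n z)
    (fun s hs => (hu.abs_stepFn hs.1).le)]
  have hc := continuous_fluxDeriv hX
  have hi : ∀ k, IntervalIntegrable (fun a => (Set.Ici (z k)).indicator 1 (Real.sin a) *
      fluxDeriv X a) volume (-(Real.pi / 2)) (Real.pi / 2) := by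
    intro k
    rw [intervalIntegrable_iff]
    refine (intervalIntegrable_iff.1 (hc.intervalIntegrable _ _)).bdd_mul (c := 1) ?_ ?_
    · exact ((measurable_one.indicator measurableSet_Ici).comp Real.measurable_sin).aestronglyMeasurable
    · refine Filter.Eventually.of_forall fun a => ?_
      by_cases h : z k ≤ Real.sin a <;> simp [Set.indicator, h]
  have he : ∀ a, stepFn n z (Real.sin a) * fluxDeriv X a = -fluxDeriv X a +
      ∑ k ∈ Icc 1 n, 2 * (-1) ^ (k + 1) *
        ((Set.Ici (z k)).indicator 1 (Real.sin a) * fluxDeriv X a) := by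
    intro a
    rw [stepFn, add_mul, neg_one_mul, mul_sum, sum_mul]
    congr 1
    exact sum_congr rfl fun k _ => by ring
  simp_rw [he]
  rw [intervalIntegral.integral_add (by exact hc.neg.intervalIntegrable _ _), intervalIntegral.integral_neg,
    integral_fluxDeriv hX, neg_zero, zero_add, intervalIntegral.integral_finsetSum, mul_sum]
  · refine sum_congr rfl fun k hk => ?_
    rw [Finset.mem_Icc] at hk
    rw [intervalIntegral.integral_const_mul, integral_indicator_mul_fluxDeriv hX
      ⟨hu.neg_one_lt hk.1 (by omega), hu.lt_one hk.2⟩]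
    ring
  · exact fun k _ => (hi k).const_mul _
  · have := IntervalIntegrable.sum (Icc 1 n) fun k _ => (hi k).const_mul (2 * (-1) ^ (k + 1))
    simpa only [Finset.sum_fn] using this

/-- The field `W(x₃) ∇x₃` on the sphere. -/
noncomputable def heightField (W : ℝ → ℝ) (x : E3) : E3 :=
  W (x 2) • (EuclideanSpace.single 2 1 - x 2 • x)

lemma inner_heightField {W : ℝ → ℝ} {x : E3} (hx : ‖x‖ = 1) : ⟪heightField W x, x⟫ = 0 := by
  have h : ⟪x, x⟫ = (1 : ℝ) := by rw [real_inner_self_eq_norm_sq, hx, one_pow]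
  rw [heightField, inner_smul_left, inner_sub_left, inner_smul_left, h]
  simp [inner_E3]

lemma norm_heightField_sq {W : ℝ → ℝ} {x : E3} (hx : ‖x‖ = 1) :
    ‖heightField W x‖ ^ 2 = W (x 2) ^ 2 * (1 - x 2 ^ 2) := by
  rw [heightField, norm_smul, mul_pow, norm_sub_sq_real]
  simp [inner_smul_right, norm_smul, hx, inner_E3]
  left
  ring

lemma isSmoothTangentField_heightField {W : ℝ → ℝ} (hW : ContDiff ℝ ∞ W) :
    IsSmoothTangentField (heightField W) where
  smooth := by
    have h : ContDiff ℝ ∞ fun x : E3 => x 2 :=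
      (EuclideanSpace.proj (2 : Fin 3) : E3 →L[ℝ] ℝ).contDiff
    exact (hW.comp h).smul (contDiff_const.sub (h.smul contDiff_id))
  tangent x := inner_heightField (norm_eq_of_mem_sphere x)

lemma flux_heightField (W : ℝ → ℝ) (a : ℝ) :
    flux (heightField W) a = 2 * Real.pi * (W (Real.sin a) * (1 - Real.sin a ^ 2)) := by
  have : ∀ t, heightField W (spherePoint a t) 2 = W (Real.sin a) * (1 - Real.sin a ^ 2) := by
    intro t
    simp [heightField, spherePoint]
    left; ring
  simp only [flux, this, intervalIntegral.integral_const, smul_eq_mul]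
  ring

/-- The numerator vanishes for `t ≤ 1/A`, hence near the singularity of `1/√t`. -/
lemma contDiff_smoothTransition_div_sqrt {A : ℝ} (hA : 0 < A) :
    ContDiff ℝ ∞ fun t : ℝ => Real.smoothTransition (A * t - 1) / √t := by
  rw [contDiff_iff_contDiffAt]
  intro t
  rcases lt_or_ge 0 t with ht | ht
  · refine ContDiffAt.div ?_ (Real.contDiffAt_sqrt ht.ne') (Real.sqrt_pos.2 ht).ne'
    exact (Real.smoothTransition.contDiff.comp (by fun_prop)).contDiffAt
  · have h : ∀ᶠ y in nhds t, A * y - 1 < 0 := by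
      refine (by fun_prop : Continuous fun y : ℝ => A * y - 1).continuousAt.eventually_lt_const ?_
      nlinarith
    refine (contDiffAt_const (c := (0 : ℝ))).congr_of_eventuallyEq ?_
    filter_upwards [h] with y hy
    rw [Real.smoothTransition.zero_of_nonpos hy.le, zero_div]

/-- `W` is the weight of an optimal calibrating field: `heightField W` has length at most one, and
length one with alternating direction on every interface. The sine of an interpolating polynomial
gives the signs without exceeding one, and a cutoff makes `1/√(1 - s²)` smooth at the poles. -/
lemma exists_contDiff_weight (n : ℕ) (z : ℕ → ℝ) (hinj : Set.InjOn z (Icc 1 n))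
    (hz : ∀ k ∈ Icc 1 n, z k ^ 2 < 1) :
    ∃ W : ℝ → ℝ, ContDiff ℝ ∞ W ∧ (∀ s, s ^ 2 ≤ 1 → W s ^ 2 * (1 - s ^ 2) ≤ 1) ∧
      ∀ k ∈ Icc 1 n, W (z k) = (-1) ^ k / √(1 - z k ^ 2) := by
  -- This makes `A(1 - z_k²) ≥ 2`, so the cutoff equals one at every interface; the summand `1`
  -- keeps `A` positive when there are none.
  set A : ℝ := 1 + ∑ k ∈ Icc 1 n, 2 / (1 - z k ^ 2) with hA
  have hpos : ∀ k ∈ Icc 1 n, 0 ≤ 2 / (1 - z k ^ 2) := fun k hk =>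
    div_nonneg (by norm_num) (by linarith [hz k hk])
  have hA0 : 0 < A := by linarith [sum_nonneg hpos]
  set q := Lagrange.interpolate (Icc 1 n) z fun k => Real.pi / 2 + k * Real.pi
  refine ⟨fun s => Real.sin (q.eval s) *
    (Real.smoothTransition (A * (1 - s ^ 2) - 1) / √(1 - s ^ 2)), ?_, ?_, ?_⟩
  · refine ContDiff.mul (Real.contDiff_sin.comp (by simpa using q.contDiff_aeval (𝕜 := ℝ) ∞)) ?_
    exact (contDiff_smoothTransition_div_sqrt hA0).comp (by fun_prop : ContDiff ℝ ∞ fun s : ℝ => 1 - s ^ 2)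
  · intro s hs
    set r := Real.smoothTransition (A * (1 - s ^ 2) - 1)
    have hr0 : 0 ≤ r := Real.smoothTransition.nonneg _
    have hr1 : r ≤ 1 := Real.smoothTransition.le_one _
    rw [mul_pow, div_pow, Real.sq_sqrt (by linarith), mul_assoc]
    refine mul_le_one₀ (Real.sin_sq_le_one _) (by have : 0 ≤ 1 - s ^ 2 := by linarith
                                                  positivity) ?_
    rcases hs.eq_or_lt with h | h
    · rw [h]; norm_num
    · rw [div_mul_cancel₀ _ (by linarith)]
      exact pow_le_one₀ hr0 hr1
  · intro k hk
    have h1 : 2 / (1 - z k ^ 2) ≤ A := by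
      linarith [single_le_sum hpos hk]
    have h2 : 0 < 1 - z k ^ 2 := by linarith [hz k hk]
    rw [div_le_iff₀ h2] at h1
    have h3 : Real.sin (q.eval (z k)) = (-1) ^ k := by
      rw [Lagrange.eval_interpolate_at_node _ hinj hk, add_comm, Real.sin_add_pi_div_two,
        Real.cos_nat_mul_pi]
    simp only [h3, Real.smoothTransition.one_of_one_le (by linarith : 1 ≤ A * (1 - z k ^ 2) - 1)]
    ring

/-- The supremum is attained by `heightField W`, so the lower bound needs no approximation. -/
theorem IsAxisymmetricPattern.totalVariation_eq {n : ℕ} {z : ℕ → ℝ} {u : S2 → ℝ}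
    (hu : IsAxisymmetricPattern n z u) :
    totalVariation u = ENNReal.ofReal (4 * Real.pi * ∑ k ∈ Icc 1 n, √(1 - z k ^ 2)) := by
  have hz : ∀ k ∈ Icc 1 n, z k ∈ Set.Ioo (-1 : ℝ) 1 := fun k hk => by
    rw [Finset.mem_Icc] at hk
    exact ⟨hu.neg_one_lt hk.1 (by omega), hu.lt_one hk.2⟩
  have hsin : ∀ k ∈ Icc 1 n, Real.sin (Real.arcsin (z k)) = z k := fun k hk =>
    Real.sin_arcsin (hz k hk).1.le (hz k hk).2.le
  have hz2 : ∀ k ∈ Icc 1 n, z k ^ 2 < 1 := fun k hk => by nlinarith [(hz k hk).1, (hz k hk).2]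
  refine le_antisymm ?_ ?_
  · refine iSup_le fun X => iSup_le fun hX => iSup_le fun h1 => ENNReal.ofReal_le_ofReal ?_
    rw [hu.integral_mul_surfaceDiv hX, mul_sum, mul_sum]
    refine sum_le_sum fun k hk => ?_
    have h := abs_flux_le hX h1 (Real.arcsin (z k))
    rw [hsin k hk] at h
    have h2 : (-1) ^ k * flux X (Real.arcsin (z k)) ≤ |flux X (Real.arcsin (z k))| := by
      refine (le_abs_self _).trans (le_of_eq ?_)
      rw [abs_mul, abs_pow]
      simp
    linarith
  · obtain ⟨W, hW, hW1, hWz⟩ := exists_contDiff_weight n z (fun i hi j hj hij => by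
      rw [Finset.coe_Icc, Set.mem_Icc] at hi hj
      rcases lt_trichotomy i j with h | h | h
      · exact absurd hij (hu.strictMono_of_le h (by omega)).ne
      · exact h
      · exact absurd hij (hu.strictMono_of_le h (by omega)).ne') hz2
    have hX := isSmoothTangentField_heightField hW
    have hn : ∀ x : S2, ‖heightField W x‖ ≤ 1 := by
      intro x
      have hx : ‖(x : E3)‖ = 1 := norm_eq_of_mem_sphere x
      have h := PiLp.norm_apply_le (x : E3) 2
      rw [hx, Real.norm_eq_abs] at h
      rw [← abs_of_nonneg (norm_nonneg (heightField W x)), ← sq_le_one_iff_abs_le_one,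
        norm_heightField_sq hx]
      exact hW1 _ ((sq_le_one_iff_abs_le_one _).2 h)
    refine le_trans (le_of_eq ?_) (le_iSup_of_le (heightField W) (le_iSup_of_le hX
      (le_iSup_of_le hn le_rfl)))
    rw [hu.integral_mul_surfaceDiv hX, mul_sum, mul_sum]
    congr 1
    refine sum_congr rfl fun k hk => ?_
    rw [flux_heightField, hsin k hk, hWz k hk]
    have h0 : 0 < 1 - z k ^ 2 := by linarith [hz2 k hk]
    have h1 : ((-1 : ℝ) ^ k) * (-1) ^ k = 1 := by rw [← mul_pow]; norm_num
    have h2 : (1 - z k ^ 2) / √(1 - z k ^ 2) = √(1 - z k ^ 2) := Real.div_sqrt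
    calc _ = 4 * Real.pi * √(1 - z k ^ 2) := rfl
      _ = 4 * Real.pi * (((-1) ^ k * (-1) ^ k) * ((1 - z k ^ 2) / √(1 - z k ^ 2))) := by
        rw [h1, h2, one_mul]
      _ = _ := by ring

theorem IsAxisymmetricPattern.memBVSign {n : ℕ} {z : ℕ → ℝ} {u : S2 → ℝ}
    (hu : IsAxisymmetricPattern n z u) : MemBVSign u where
  integrable := hu.integrable
  finite_variation := by
    rw [hu.totalVariation_eq]
    exact ENNReal.ofReal_lt_top
  sign := Filter.Eventually.of_forall fun x => by
    rw [hu.eq_stepFn, ← abs_eq zero_le_one]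
    have h := PiLp.norm_apply_le (x : E3) 2
    rw [norm_eq_of_mem_sphere x, Real.norm_eq_abs] at h
    exact hu.abs_stepFn (abs_le.1 h).1

/-! ### Sobolev functions of the height. -/

lemma abs_height_le (x : S2) : |(x : E3) 2| ≤ 1 := by
  have h := PiLp.norm_apply_le (x : E3) 2
  rwa [norm_eq_of_mem_sphere x, Real.norm_eq_abs] at h

lemma height_mem_Icc (x : S2) : (x : E3) 2 ∈ Set.Icc (-1 : ℝ) 1 := abs_le.1 (abs_height_le x)

lemma measurable_heightField {W : ℝ → ℝ} (hW : Measurable W) : Measurable (heightField W) := by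
  have h : Measurable fun x : E3 => x 2 := by fun_prop
  exact (hW.comp h).smul (measurable_const.sub (h.smul measurable_id))

/-- A bound on the open interval suffices because the field is zero at the poles whatever `W` is
there. -/
lemma norm_heightField_le {W : ℝ → ℝ} {K : ℝ} (hK : 0 ≤ K) (hW : ∀ s ∈ Set.Ioo (-1 : ℝ) 1, |W s| ≤ K)
    (x : S2) : ‖heightField W x‖ ≤ K := by
  refine le_of_sq_le_sq ?_ hK
  rw [norm_heightField_sq (norm_eq_of_mem_sphere x)]
  have h1 := (sq_le_one_iff_abs_le_one _).2 (abs_height_le x)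
  rcases h1.eq_or_lt with h | h
  · rw [h, sub_self, mul_zero]
    exact sq_nonneg K
  · have h2 : |W ((x : E3) 2)| ^ 2 ≤ K ^ 2 := by
      gcongr
      exact hW _ (abs_lt.1 ((sq_lt_one_iff_abs_lt_one _).1 h))
    rw [sq_abs] at h2
    nlinarith [sq_nonneg (W ((x : E3) 2)), sq_nonneg ((x : E3) 2)]

lemma inner_heightField_of_tangent {W : ℝ → ℝ} {x y : E3} (hy : ⟪y, x⟫ = 0) :
    ⟪heightField W x, y⟫ = W (x 2) * y 2 := by
  rw [heightField, inner_smul_left, inner_sub_left, inner_smul_left, real_inner_comm y x, hy]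
  simp [inner_E3]

/-- The right-hand side is the derivative of `(1 - s²)W(s)`, so solving for a prescribed divergence
is a single integration. -/
lemma surfaceDiv_heightField {W : ℝ → ℝ} (hW : ContDiff ℝ ∞ W) {x : E3} (hx : ‖x‖ = 1) :
    surfaceDiv (heightField W) x = (1 - x 2 ^ 2) * deriv W (x 2) - 2 * x 2 * W (x 2) := by
  have hp : HasFDerivAt (fun x : E3 => x 2) (EuclideanSpace.proj (2 : Fin 3) : E3 →L[ℝ] ℝ) x :=
    (EuclideanSpace.proj (2 : Fin 3) : E3 →L[ℝ] ℝ).hasFDerivAt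
  have h1 : HasFDerivAt (fun x : E3 => W (x 2))
      (deriv W (x 2) • (EuclideanSpace.proj (2 : Fin 3) : E3 →L[ℝ] ℝ)) x :=
    ((hW.differentiable (by simp)) (x 2)).hasDerivAt.comp_hasFDerivAt x hp
  have h2 : HasFDerivAt (fun x : E3 => (EuclideanSpace.single 2 1 : E3) - x 2 • x) _ x :=
    (hasFDerivAt_const _ x).sub (hp.smul (hasFDerivAt_id x))
  have h3 : HasFDerivAt (heightField W) _ x := h1.smul h2
  have hn : x 0 ^ 2 + x 1 ^ 2 + x 2 ^ 2 = 1 := by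
    have := real_inner_self_eq_norm_sq x
    rw [inner_E3, hx] at this
    linarith
  rw [surfaceDiv, h3.fderiv, Fin.sum_univ_three, inner_E3]
  simp
  linear_combination (2 * W (x 2) * x 2 + deriv W (x 2) * x 2 ^ 2) * hn

lemma intervalIntegrable_of_abs_le {f : ℝ → ℝ} (hf : Measurable f) {K : ℝ} (hK : ∀ s, |f s| ≤ K)
    (a b : ℝ) : IntervalIntegrable f volume a b :=
  (intervalIntegrable_const (c := K)).mono_fun' hf.aestronglyMeasurable
    (Filter.Eventually.of_forall hK)

/-- A function of the height which is continuous, with bounded derivative away from the poles,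
belongs to the Sobolev space. -/
lemma hasWeakGradient_height {V w : ℝ → ℝ} {K : ℝ} (hV : Continuous V) (hw : Measurable w)
    (hK : ∀ s, |w s| ≤ K) (hVw : ∀ s ∈ Set.Ioo (-1 : ℝ) 1, HasDerivAt V (w s) s) :
    HasWeakGradient (fun x => V ((x : E3) 2)) (fun x => heightField w x) := by
  have hK0 : 0 ≤ K := (abs_nonneg _).trans (hK 0)
  have hVc : Continuous fun x : S2 => V ((x : E3) 2) := by fun_prop
  refine ⟨?_, ?_, ?_, ?_⟩
  · obtain ⟨C, hC⟩ := isCompact_univ.exists_bound_of_continuousOn hVc.continuousOn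
    exact MemLp.of_bound hVc.aestronglyMeasurable C
      (Filter.Eventually.of_forall fun x => hC x (Set.mem_univ x))
  · refine MemLp.of_bound ?_ K (Filter.Eventually.of_forall fun x =>
      norm_heightField_le hK0 (fun s _ => hK s) x)
    exact ((measurable_heightField hw).comp measurable_subtype_coe).aestronglyMeasurable
  · exact Filter.Eventually.of_forall fun x => inner_heightField (norm_eq_of_mem_sphere x)
  · intro X hX
    obtain ⟨C, hC⟩ := isCompact_Icc.exists_bound_of_continuousOn (hV.continuousOn (s := Set.Icc (-1) 1))
    have h1 : ∀ x : S2, ⟪heightField w x, X x⟫ = w ((x : E3) 2) * X x 2 := fun x =>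
      inner_heightField_of_tangent (hX.tangent x)
    simp_rw [h1]
    rw [integral_height_mul_surfaceDiv hX hV.measurable hC,
      integral_height_mul_coord hX hw (fun s _ => hK s),
      -- Integration by parts in the latitude; the boundary terms vanish with the flux at the poles.
      intervalIntegral.integral_mul_deriv_eq_deriv_mul_of_hasDerivAt
        (u := fun a => V (Real.sin a)) (u' := fun a => Real.cos a * w (Real.sin a)) (v := flux X)
        (by fun_prop) (continuous_flux hX).continuousOn _
        (fun a _ => hasDerivAt_flux hX a) _ ((continuous_fluxDeriv hX).intervalIntegrable _ _),
      flux_pole hX Real.cos_pi_div_two, flux_pole hX (by simp)]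
    · simp
    · intro a ha
      rw [min_eq_left (by linarith [Real.pi_pos]), max_eq_right (by linarith [Real.pi_pos])] at ha
      have hmem : Real.sin a ∈ Set.Ioo (-1 : ℝ) 1 := by
        have hc := Real.cos_pos_of_mem_Ioo ha
        have := Real.sin_sq_add_cos_sq a
        rw [Set.mem_Ioo, ← abs_lt, ← sq_lt_one_iff_abs_lt_one]
        nlinarith
      have := (hVw _ hmem).comp a (Real.hasDerivAt_sin a)
      rwa [mul_comm] at this
    · refine intervalIntegrable_of_abs_le (Real.measurable_cos.mul (hw.comp Real.measurable_sin))
        (K := K) (fun a => ?_) _ _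
      rw [Pi.mul_apply, abs_mul]
      exact (mul_le_of_le_one_left (abs_nonneg _) (Real.abs_cos_le_one a)).trans (hK _)

/-- Integrating from the nearer pole gives `K(1 - |s|)`, which is at most `K(1 - s²)`. This bounds
the quotient by `1 - s²` up to the poles. -/
lemma abs_primitive_le {f : ℝ → ℝ} {K : ℝ} (hK : ∀ s ∈ Set.Icc (-1 : ℝ) 1, |f s| ≤ K)
    (hf : IntervalIntegrable f volume (-1) 1) (h0 : ∫ s in (-1 : ℝ)..1, f s = 0) {s : ℝ}
    (hs : s ∈ Set.Icc (-1 : ℝ) 1) : |∫ r in (-1 : ℝ)..s, f r| ≤ K * (1 - s ^ 2) := by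
  have hK0 : 0 ≤ K := (abs_nonneg _).trans (hK s hs)
  rcases le_total s 0 with h | h
  · have := intervalIntegral.norm_integral_le_of_norm_le_const (a := -1) (b := s) (f := f) (C := K)
      fun r hr => by
        rw [Set.uIoc_of_le hs.1] at hr
        exact hK r ⟨hr.1.le, hr.2.trans hs.2⟩
    rw [abs_of_nonneg (by linarith [hs.1])] at this
    refine this.trans (mul_le_mul_of_nonneg_left ?_ hK0)
    nlinarith [hs.1]
  · have := intervalIntegral.norm_integral_le_of_norm_le_const (a := s) (b := 1) (f := f) (C := K)
      fun r hr => by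
        rw [Set.uIoc_of_le hs.2] at hr
        exact hK r ⟨hs.1.trans hr.1.le, hr.2⟩
    rw [abs_of_nonneg (by linarith [hs.2])] at this
    have h2 : ∫ r in (-1 : ℝ)..s, f r = -∫ r in s..1, f r := by
      rw [← add_eq_zero_iff_eq_neg, intervalIntegral.integral_add_adjacent_intervals, h0]
      · exact hf.mono_set (by rw [Set.uIcc_of_le hs.1, Set.uIcc_of_le (by norm_num)]
                              exact Set.Icc_subset_Icc_right hs.2)
      · exact hf.mono_set (by rw [Set.uIcc_of_le hs.2, Set.uIcc_of_le (by norm_num)]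
                              exact Set.Icc_subset_Icc_left hs.1)
    rw [h2, abs_neg]
    refine this.trans (mul_le_mul_of_nonneg_left ?_ hK0)
    nlinarith [hs.2]

/-! ### The axisymmetric Poisson problem. -/

/-- The derivative, as a function of the height, of the axisymmetric solution of the Poisson
problem with right-hand side `f`. -/
noncomputable def poissonSlope (f : ℝ → ℝ) : ℝ → ℝ :=
  (Set.Ioo (-1) 1).indicator fun s => -(∫ r in (-1 : ℝ)..s, f r) / (1 - s ^ 2)

lemma continuous_primitive {f : ℝ → ℝ} (hf : Measurable f) {K : ℝ} (hK : ∀ s, |f s| ≤ K) :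
    Continuous fun s => ∫ r in (-1 : ℝ)..s, f r :=
  intervalIntegral.continuous_primitive (intervalIntegrable_of_abs_le hf hK) _

lemma measurable_poissonSlope {f : ℝ → ℝ} (hf : Measurable f) {K : ℝ} (hK : ∀ s, |f s| ≤ K) :
    Measurable (poissonSlope f) := by
  refine Measurable.indicator ?_ measurableSet_Ioo
  have := continuous_primitive hf hK
  fun_prop

lemma abs_poissonSlope_le {f : ℝ → ℝ} (hf : Measurable f) {K : ℝ} (hK : ∀ s, |f s| ≤ K)
    (h0 : ∫ s in (-1 : ℝ)..1, f s = 0) (s : ℝ) : |poissonSlope f s| ≤ K := by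
  by_cases hs : s ∈ Set.Ioo (-1 : ℝ) 1
  · have h1 : 0 < 1 - s ^ 2 := by nlinarith [hs.1, hs.2]
    rw [poissonSlope, Set.indicator_of_mem hs, abs_div, abs_neg, abs_of_pos h1, div_le_iff₀ h1]
    exact abs_primitive_le (fun s _ => hK s) (intervalIntegrable_of_abs_le hf hK _ _) h0
      (Set.Ioo_subset_Icc_self hs)
  · rw [poissonSlope, Set.indicator_of_notMem hs, abs_zero]
    exact (abs_nonneg _).trans (hK 0)

/-- Even if `f` jumps, its primitive is continuous; the slope is then continuous inside `(-1, 1)`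
and is a genuine derivative there. -/
lemma hasWeakGradient_poissonSlope {f : ℝ → ℝ} (hf : Measurable f) {K : ℝ} (hK : ∀ s, |f s| ≤ K)
    (h0 : ∫ s in (-1 : ℝ)..1, f s = 0) :
    HasWeakGradient (fun x => ∫ s in (0 : ℝ)..((x : E3) 2), poissonSlope f s)
      (fun x => heightField (poissonSlope f) x) := by
  have hm := measurable_poissonSlope hf hK
  have hb := abs_poissonSlope_le hf hK h0
  have hi := intervalIntegrable_of_abs_le hm hb
  refine hasWeakGradient_height (V := fun s => ∫ r in (0 : ℝ)..s, poissonSlope f r)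
    (intervalIntegral.continuous_primitive hi 0) hm hb fun s hs => ?_
  refine intervalIntegral.integral_hasDerivAt_right (hi _ _)
    hm.stronglyMeasurable.stronglyMeasurableAtFilter ?_
  have hc : ContinuousAt (fun s => -(∫ r in (-1 : ℝ)..s, f r) / (1 - s ^ 2)) s := by
    refine (continuous_primitive hf hK).continuousAt.neg.div (by fun_prop) ?_
    nlinarith [hs.1, hs.2]
  refine hc.congr ?_
  filter_upwards [isOpen_Ioo.mem_nhds hs] with r hr
  rw [poissonSlope, Set.indicator_of_mem hr]

open Polynomial in
lemma exists_derivative_eq (p : ℝ[X]) : ∃ Q : ℝ[X], derivative Q = p := by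
  induction p using Polynomial.induction_on' with
  | add p q hp hq =>
    obtain ⟨P, rfl⟩ := hp
    obtain ⟨Q, rfl⟩ := hq
    exact ⟨P + Q, derivative_add⟩
  | monomial k a =>
    refine ⟨monomial (k + 1) (a / (k + 1)), ?_⟩
    rw [derivative_monomial]
    congr 1
    push_cast
    field_simp

-- The primitive vanishes at both endpoints, so `1 - s²` divides it. The polynomial quotient gives a
-- smooth tangent field whose divergence is `p`, admissible in the definition of weak gradient.
open Polynomial in
lemma exists_polynomial_primitive {p : ℝ[X]} (h0 : ∫ s in (-1 : ℝ)..1, p.eval s = 0) :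
    ∃ W : ℝ[X], (∀ s, (1 - s ^ 2) * W.eval s = ∫ r in (-1 : ℝ)..s, p.eval r) ∧
      ∀ s, (1 - s ^ 2) * (derivative W).eval s - 2 * s * W.eval s = p.eval s := by
  obtain ⟨Q, hQ⟩ := exists_derivative_eq p
  have hint : ∀ s, ∫ r in (-1 : ℝ)..s, p.eval r = Q.eval s - Q.eval (-1) := fun s =>
    intervalIntegral.integral_eq_sub_of_hasDerivAt (fun r _ => hQ ▸ Q.hasDerivAt r)
      (p.continuous.intervalIntegrable _ _)
  set P := Q - C (Q.eval (-1)) with hP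
  have h1 : X - C (-1) ∣ P := by
    rw [dvd_iff_isRoot]; simp [hP]
  have h2 : X - C 1 ∣ P := by
    rw [dvd_iff_isRoot]; simpa [hP, hint] using h0
  have hcop : IsCoprime (X - C (-1 : ℝ)) (X - C 1) :=
    isCoprime_X_sub_C_of_isUnit_sub (by norm_num)
  obtain ⟨R, hR⟩ := hcop.mul_dvd h1 h2
  have hR' : Q = (1 - X ^ 2) * (-R) + C (Q.eval (-1)) := by
    rw [← sub_eq_iff_eq_add, ← hP, hR]
    simp only [map_neg, map_one]
    ring
  refine ⟨-R, fun s => ?_, fun s => ?_⟩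
  · rw [hint]
    have := congrArg (eval s) hR'
    simp only [eval_add, eval_mul, eval_sub, eval_one, eval_pow, eval_X, eval_C] at this
    linarith
  · have := congrArg (fun q => eval s (derivative q)) hR'
    simp only [hQ, derivative_add, derivative_mul, derivative_sub, derivative_one, derivative_X_pow,
      derivative_C, eval_add, eval_mul, eval_sub, eval_one, eval_pow, eval_X, eval_C, eval_zero] at this
    rw [this]
    push_cast
    ring

open Polynomial in
lemma integral_weakGradient_polynomial {φ : S2 → ℝ} {h : S2 → E3} (hφ : HasWeakGradient φ h)
    {p W : ℝ[X]} (hW : ∀ s, (1 - s ^ 2) * (derivative W).eval s - 2 * s * W.eval s = p.eval s) :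
    ∫ x : S2, φ x * p.eval ((x : E3) 2) ∂surfaceMeasure =
      -∫ x : S2, ⟪h x, heightField (fun s => W.eval s) x⟫ ∂surfaceMeasure := by
  have hc : ContDiff ℝ ∞ fun s => W.eval s := by simpa using W.contDiff_aeval (𝕜 := ℝ) ∞
  rw [← hφ.integral_eq _ (isSmoothTangentField_heightField hc)]
  refine integral_congr_ae (Filter.Eventually.of_forall fun x => ?_)
  simp only
  rw [surfaceDiv_heightField hc (norm_eq_of_mem_sphere x), Polynomial.deriv, hW]

-- Weierstrass approximation followed by subtraction of the mean, which tends to zero and at most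
-- doubles the bound. Convergence at every height avoids null sets on the sphere.
open Polynomial in
lemma exists_polynomial_tendsto {f : ℝ → ℝ} {K : ℝ} {G : ℕ → ℝ → ℝ} (hG : ∀ j, Continuous (G j))
    (hGK : ∀ j, ∀ s, |G j s| ≤ K) (hGf : ∀ s, Filter.Tendsto (G · s) Filter.atTop (nhds (f s)))
    (h0 : ∫ s in (-1 : ℝ)..1, f s = 0) :
    ∃ p : ℕ → ℝ[X], (∀ j, ∫ s in (-1 : ℝ)..1, (p j).eval s = 0) ∧
      (∀ j, ∀ s ∈ Set.Icc (-1 : ℝ) 1, |(p j).eval s| ≤ 2 * (K + 1)) ∧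
      ∀ s ∈ Set.Icc (-1 : ℝ) 1, Filter.Tendsto (fun j => (p j).eval s) Filter.atTop (nhds (f s)) := by
  choose q hq using fun j : ℕ => exists_polynomial_near_of_continuousOn (-1) 1 (G j)
    (hG j).continuousOn (1 / ((j : ℝ) + 1)) (by positivity)
  have hqK : ∀ j, ∀ s ∈ Set.Icc (-1 : ℝ) 1, |(q j).eval s| ≤ K + 1 := fun j s hs => by
    have h1 := hq j s hs
    have h2 : 1 / ((j : ℝ) + 1) ≤ 1 := by
      rw [div_le_one (by positivity)]; linarith [Nat.cast_nonneg (α := ℝ) j]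
    have h3 := abs_sub_abs_le_abs_sub ((q j).eval s) (G j s)
    linarith [hGK j s]
  have hqf : ∀ s ∈ Set.Icc (-1 : ℝ) 1,
      Filter.Tendsto (fun j => (q j).eval s) Filter.atTop (nhds (f s)) := fun s hs => by
    have h1 : Filter.Tendsto (fun j => (q j).eval s - G j s) Filter.atTop (nhds 0) :=
      squeeze_zero_norm (fun j => (hq j s hs).le) tendsto_one_div_add_atTop_nhds_zero_nat
    simpa using h1.add (hGf s)
  have hmean : Filter.Tendsto (fun j => ∫ s in (-1 : ℝ)..1, (q j).eval s) Filter.atTop (nhds 0) := by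
    rw [← h0]
    refine intervalIntegral.tendsto_integral_filter_of_dominated_convergence (fun _ => K + 1)
      (Filter.Eventually.of_forall fun j => (q j).continuous.aestronglyMeasurable) ?_ (by simp) ?_
    · refine Filter.Eventually.of_forall fun j => Filter.Eventually.of_forall fun s hs => ?_
      rw [Set.uIoc_of_le (by norm_num)] at hs
      exact hqK j s (Set.Ioc_subset_Icc_self hs)
    · refine Filter.Eventually.of_forall fun s hs => ?_
      rw [Set.uIoc_of_le (by norm_num)] at hs
      exact hqf s (Set.Ioc_subset_Icc_self hs)
  refine ⟨fun j => q j - C ((∫ s in (-1 : ℝ)..1, (q j).eval s) / 2), fun j => ?_, fun j s hs => ?_,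
    fun s hs => ?_⟩
  · simp only [eval_sub, eval_C]
    rw [intervalIntegral.integral_sub ((q j).continuous.intervalIntegrable _ _) (by simp),
      intervalIntegral.integral_const, smul_eq_mul]
    ring
  · simp only [eval_sub, eval_C]
    have h1 := intervalIntegral.norm_integral_le_of_norm_le_const (a := -1) (b := 1)
      (f := fun s => (q j).eval s) (C := K + 1) fun r hr => by
        rw [Set.uIoc_of_le (by norm_num)] at hr
        exact hqK j r (Set.Ioc_subset_Icc_self hr)
    rw [Real.norm_eq_abs] at h1
    norm_num at h1
    have h2 := abs_sub ((q j).eval s) ((∫ s in (-1 : ℝ)..1, (q j).eval s) / 2)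
    rw [abs_div, abs_two] at h2
    linarith [hqK j s hs]
  · simp only [eval_sub, eval_C]
    simpa using (hqf s hs).sub (hmean.div_const 2)

open Polynomial in
/-- The axisymmetric solution of the Poisson problem. -/
theorem isPoissonSolution_poissonSlope {f : ℝ → ℝ} (hf : Measurable f) {K : ℝ} {G : ℕ → ℝ → ℝ}
    (hG : ∀ j, Continuous (G j)) (hGK : ∀ j, ∀ s, |G j s| ≤ K)
    (hGf : ∀ s, Filter.Tendsto (G · s) Filter.atTop (nhds (f s)))
    (h0 : ∫ s in (-1 : ℝ)..1, f s = 0) {u : S2 → ℝ} {m : ℝ} (hu : ∀ x, u x - m = f ((x : E3) 2)) :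
    IsPoissonSolution u m (fun x => ∫ s in (0 : ℝ)..((x : E3) 2), poissonSlope f s)
      (fun x => heightField (poissonSlope f) x) := by
  have hK : ∀ s, |f s| ≤ K := fun s =>
    le_of_tendsto (hGf s).abs (Filter.Eventually.of_forall fun j => hGK j s)
  have hK0 : 0 ≤ K := (abs_nonneg _).trans (hK 0)
  refine ⟨hasWeakGradient_poissonSlope hf hK h0, fun φ h hφ => ?_⟩
  obtain ⟨p, hp0, hpK, hpf⟩ := exists_polynomial_tendsto hG hGK hGf h0
  choose W hW1 hW2 using fun j => exists_polynomial_primitive (hp0 j)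
  have hφi : Integrable φ surfaceMeasure := hφ.memLp.integrable (by norm_num)
  have hhi : Integrable h surfaceMeasure := hφ.memLp_grad.integrable (by norm_num)
  -- A bound uniform in `j`, used for domination: the primitive estimate survives division by `1 -
  -- s²`.
  have hWK : ∀ j, ∀ s ∈ Set.Ioo (-1 : ℝ) 1, |(W j).eval s| ≤ 2 * (K + 1) := fun j s hs => by
    have h1 : 0 < 1 - s ^ 2 := by nlinarith [hs.1, hs.2]
    have h2 := abs_primitive_le (hpK j) ((p j).continuous.intervalIntegrable _ _) (hp0 j)
      (Set.Ioo_subset_Icc_self hs)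
    rw [← hW1, abs_mul, abs_of_pos h1, mul_comm] at h2
    exact le_of_mul_le_mul_right h2 h1
  have hWlim : ∀ s ∈ Set.Ioo (-1 : ℝ) 1, Filter.Tendsto (fun j => (W j).eval s) Filter.atTop
      (nhds (-poissonSlope f s)) := fun s hs => by
    have h1 : 0 < 1 - s ^ 2 := by nlinarith [hs.1, hs.2]
    have h2 : Filter.Tendsto (fun j => ∫ r in (-1 : ℝ)..s, (p j).eval r) Filter.atTop
        (nhds (∫ r in (-1 : ℝ)..s, f r)) := by
      refine intervalIntegral.tendsto_integral_filter_of_dominated_convergence (fun _ => 2 * (K + 1))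
        (Filter.Eventually.of_forall fun j => (p j).continuous.aestronglyMeasurable) ?_ (by simp) ?_
      · refine Filter.Eventually.of_forall fun j => Filter.Eventually.of_forall fun r hr => ?_
        rw [Set.uIoc_of_le hs.1.le] at hr
        exact hpK j r ⟨hr.1.le, hr.2.trans hs.2.le⟩
      · refine Filter.Eventually.of_forall fun r hr => ?_
        rw [Set.uIoc_of_le hs.1.le] at hr
        exact hpf r ⟨hr.1.le, hr.2.trans hs.2.le⟩
    have h3 : ∀ j, (W j).eval s = (∫ r in (-1 : ℝ)..s, (p j).eval r) / (1 - s ^ 2) := fun j => by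
      rw [← hW1, mul_div_cancel_left₀ _ h1.ne']
    simp_rw [h3]
    rw [poissonSlope, Set.indicator_of_mem hs, neg_div, neg_neg]
    exact h2.div_const _
  have hlim : ∀ x : S2, Filter.Tendsto (fun j => heightField (fun s => (W j).eval s) x) Filter.atTop
      (nhds (-heightField (poissonSlope f) x)) := fun x => by
    by_cases hx : (x : E3) 2 ∈ Set.Ioo (-1 : ℝ) 1
    · simp only [heightField, ← neg_smul]
      exact (hWlim _ hx).smul_const _
    -- At the poles all height fields vanish, so no limit of `W j` is needed there.
    · have h1 : (x : E3) 2 ^ 2 = 1 := by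
        refine le_antisymm ((sq_le_one_iff_abs_le_one _).2 (abs_height_le x)) ?_
        rwa [Set.mem_Ioo, ← abs_lt, ← sq_lt_one_iff_abs_lt_one, not_lt] at hx
      have h2 : ∀ W, heightField W x = 0 := fun W => by
        have := norm_heightField_sq (W := W) (norm_eq_of_mem_sphere x)
        rw [h1, sub_self, mul_zero] at this
        exact norm_eq_zero.1 (pow_eq_zero_iff two_ne_zero |>.1 this)
      simp [h2]
  have hL : Filter.Tendsto (fun j => ∫ x : S2, φ x * (p j).eval ((x : E3) 2) ∂surfaceMeasure)
      Filter.atTop (nhds (∫ x : S2, φ x * f ((x : E3) 2) ∂surfaceMeasure)) := by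
    refine tendsto_integral_of_dominated_convergence (fun x => ‖φ x‖ * (2 * (K + 1))) (fun j => ?_)
      (hφi.norm.mul_const _) (fun j => ?_) ?_
    · have : Continuous fun x : S2 => (p j).eval ((x : E3) 2) := (p j).continuous.comp (by fun_prop)
      exact hφi.aestronglyMeasurable.mul this.aestronglyMeasurable
    · refine Filter.Eventually.of_forall fun x => ?_
      rw [norm_mul]
      gcongr
      exact hpK j _ (height_mem_Icc x)
    · exact Filter.Eventually.of_forall fun x => (hpf _ (height_mem_Icc x)).const_mul _
  have hR : Filter.Tendsto
      (fun j => ∫ x : S2, ⟪h x, heightField (fun s => (W j).eval s) x⟫ ∂surfaceMeasure)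
      Filter.atTop (nhds (∫ x : S2, ⟪h x, -heightField (poissonSlope f) x⟫ ∂surfaceMeasure)) := by
    refine tendsto_integral_of_dominated_convergence (fun x => ‖h x‖ * (2 * (K + 1))) (fun j => ?_)
      (hhi.norm.mul_const _) (fun j => ?_) ?_
    · exact hhi.aestronglyMeasurable.inner ((measurable_heightField (W j).continuous.measurable).comp
        measurable_subtype_coe).aestronglyMeasurable
    · refine Filter.Eventually.of_forall fun x => (norm_inner_le_norm _ _).trans ?_
      gcongr
      exact norm_heightField_le (by positivity) (hWK j) x
    · exact Filter.Eventually.of_forall fun x => tendsto_const_nhds.inner (hlim x)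
  have heq := fun j => integral_weakGradient_polynomial hφ (hW2 j)
  simp_rw [heq] at hL
  have := tendsto_nhds_unique hL hR.neg
  simp only [inner_neg_right, integral_neg, neg_neg] at this
  simp_rw [hu, real_inner_comm (h _)]
  rw [← this]
  simp_rw [mul_comm]

/-! ### Continuous approximation of the step function. -/

/-- One bound serving both `stepFn` and `rampFn`, whose jumps and ramps take values in `[0, 1]`. -/
lemma abs_alternating_sum_le (n : ℕ) {c : ℕ → ℝ} (hc : ∀ k, c k ∈ Set.Icc (0 : ℝ) 1) (m : ℝ) :
    |-1 + 2 * ∑ k ∈ Icc 1 n, (-1) ^ (k + 1) * c k - m| ≤ 1 + 2 * n + |m| := by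
  have h1 : |∑ k ∈ Icc 1 n, (-1) ^ (k + 1) * c k| ≤ n := by
    refine (abs_sum_le_sum_abs _ _).trans ?_
    refine (sum_le_card_nsmul _ _ 1 fun k _ => ?_).trans (by simp)
    rw [abs_mul, abs_pow, abs_neg, abs_one, one_pow, one_mul, abs_of_nonneg (hc k).1]
    exact (hc k).2
  rw [abs_le] at h1 ⊢
  constructor <;> cases abs_cases m <;> linarith [h1.1, h1.2]

/-- A continuous approximation of `stepFn`. -/
noncomputable def rampFn (n : ℕ) (z : ℕ → ℝ) (j : ℕ) (s : ℝ) : ℝ :=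
  -1 + 2 * ∑ k ∈ Icc 1 n, (-1) ^ (k + 1) * max 0 (min 1 (1 + j * (s - z k)))

lemma continuous_rampFn (n : ℕ) (z : ℕ → ℝ) (j : ℕ) : Continuous (rampFn n z j) := by
  unfold rampFn
  fun_prop

lemma abs_rampFn_sub_le (n : ℕ) (z : ℕ → ℝ) (j : ℕ) (s m : ℝ) :
    |rampFn n z j s - m| ≤ 1 + 2 * n + |m| :=
  abs_alternating_sum_le n (fun _ => ⟨le_max_left _ _, max_le zero_le_one (min_le_left _ _)⟩) m

/-- Each ramp lies to the left of `z k` and already equals one there, matching the closed half-line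
in `stepFn`; the sequence is eventually constant at each height. -/
lemma tendsto_rampFn (n : ℕ) (z : ℕ → ℝ) (s : ℝ) :
    Filter.Tendsto (fun j => rampFn n z j s) Filter.atTop (nhds (stepFn n z s)) := by
  refine ((tendsto_finsetSum _ fun k _ => Filter.Tendsto.const_mul _ ?_).const_mul 2).const_add (-1)
  refine tendsto_const_nhds.congr' ?_
  by_cases h : z k ≤ s
  · refine Filter.Eventually.of_forall fun j => ?_
    have : 0 ≤ (j : ℝ) * (s - z k) := mul_nonneg (Nat.cast_nonneg j) (by linarith)
    beta_reduce
    rw [min_eq_left (by linarith), max_eq_right zero_le_one, Set.indicator_of_mem (by exact h)]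
    rfl
  · have hpos : 0 < z k - s := by linarith [not_le.1 h]
    filter_upwards [tendsto_natCast_atTop_atTop.eventually_ge_atTop (1 / (z k - s))] with j hj
    rw [div_le_iff₀ hpos] at hj
    rw [Set.indicator_of_notMem (by exact h), max_eq_left]
    exact (min_le_right _ _).trans (by linarith)

/-! ### The Dirichlet energy, zone by zone. -/

lemma xi_succ (m : ℝ) (z : ℕ → ℝ) (k : ℕ) :
    xi m z (k + 1) = xi m z k + ((-1) ^ (k + 1) - m) * (z (k + 1) - z k) := by
  simp only [xi, Finset.sum_Icc_succ_top (Nat.le_add_left 1 k), Nat.add_sub_cancel]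
  ring

/-- The alternative `A = 0` covers the zone touching the pole `1`: both sides are then zero,
whatever value the logarithm takes. -/
lemma integral_sq_mul_inv_one_sub {A a b : ℝ} (hab : a ≤ b) (hb : A = 0 ∨ b < 1) :
    IntervalIntegrable (fun s => A ^ 2 * (1 - s)⁻¹) volume a b ∧
      ∫ s in a..b, A ^ 2 * (1 - s)⁻¹ = A ^ 2 * Real.log ((1 - a) / (1 - b)) := by
  rcases hb with rfl | hb
  · simp
  have hne : ∀ s ∈ Set.uIcc a b, 1 - s ≠ 0 := fun s hs => by
    rw [Set.uIcc_of_le hab] at hs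
    linarith [hs.2]
  constructor
  · exact (ContinuousOn.mul (by fun_prop) (ContinuousOn.inv₀ (by fun_prop) hne)).intervalIntegrable
  · rw [intervalIntegral.integral_const_mul, intervalIntegral.integral_comp_sub_left (fun s => s⁻¹),
      integral_inv_of_pos (by linarith) (by linarith)]

lemma integral_sq_mul_inv_one_add {B a b : ℝ} (hab : a ≤ b) (ha : B = 0 ∨ -1 < a) :
    IntervalIntegrable (fun s => B ^ 2 * (1 + s)⁻¹) volume a b ∧
      ∫ s in a..b, B ^ 2 * (1 + s)⁻¹ = B ^ 2 * Real.log ((1 + b) / (1 + a)) := by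
  rcases ha with rfl | ha
  · simp
  have hne : ∀ s ∈ Set.uIcc a b, 1 + s ≠ 0 := fun s hs => by
    rw [Set.uIcc_of_le hab] at hs
    linarith [hs.1]
  constructor
  · exact (ContinuousOn.mul (by fun_prop) (ContinuousOn.inv₀ (by fun_prop) hne)).intervalIntegrable
  · rw [intervalIntegral.integral_const_mul, intervalIntegral.integral_comp_add_left (fun s => s⁻¹),
      integral_inv_of_pos (by linarith) (by linarith)]

/-- The Dirichlet energy of the solution on a zone on which the primitive of the right-hand side
is affine. -/
lemma integral_sq_affine_div {ξ c a b : ℝ} {F : ℝ → ℝ} (hab : a ≤ b) (ha : -1 ≤ a) (hb : b ≤ 1)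
    (hA : ξ - c * (1 - a) = 0 ∨ b < 1) (hB : ξ + c * (1 + a) = 0 ∨ -1 < a)
    (hF : ∀ s ∈ Set.Ioo a b, F s = (ξ - c * (s - a)) ^ 2 / (1 - s ^ 2)) :
    IntervalIntegrable F volume a b ∧
    ∫ s in a..b, F s = ((ξ - c * (1 - a)) ^ 2 * Real.log ((1 - a) / (1 - b)) +
      (ξ + c * (1 + a)) ^ 2 * Real.log ((1 + b) / (1 + a))) / 2 - c ^ 2 * (b - a) := by
  obtain ⟨hi1, h1⟩ := integral_sq_mul_inv_one_sub hab hA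
  obtain ⟨hi2, h2⟩ := integral_sq_mul_inv_one_add hab hB
  have hi := (hi1.add hi2).div_const 2
  have hi3 : IntervalIntegrable (fun _ : ℝ => c ^ 2) volume a b := intervalIntegrable_const
  -- Partial fractions: the residues are half the squares of the affine function at `1` and `-1`,
  -- and `-c²` is the polynomial part.
  have hae : ∀ s ∈ Set.Ioo a b, ((ξ - c * (1 - a)) ^ 2 * (1 - s)⁻¹ +
      (ξ + c * (1 + a)) ^ 2 * (1 + s)⁻¹) / 2 - c ^ 2 = F s := fun s hs => by
    have hs1 : 1 - s ≠ 0 := by linarith [hs.2]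
    have hs2 : 1 + s ≠ 0 := by linarith [hs.1]
    have hs3 : 1 - s ^ 2 = (1 - s) * (1 + s) := by ring
    rw [hF s hs, hs3]
    field_simp
    ring
  have hae' : ∀ᵐ s, s ∈ Set.uIoc a b → ((ξ - c * (1 - a)) ^ 2 * (1 - s)⁻¹ +
      (ξ + c * (1 + a)) ^ 2 * (1 + s)⁻¹) / 2 - c ^ 2 = F s := by
    have : ∀ᵐ s : ℝ, s ≠ b := by simp [ae_iff, measure_singleton]
    filter_upwards [this] with s hsb hs
    rw [Set.uIoc_of_le hab] at hs
    exact hae s ⟨hs.1, lt_of_le_of_ne hs.2 hsb⟩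
  refine ⟨(hi.sub hi3).congr_ae ((ae_restrict_iff' measurableSet_uIoc).2 hae'), ?_⟩
  rw [← intervalIntegral.integral_congr_ae hae', intervalIntegral.integral_sub hi hi3,
    intervalIntegral.integral_div, intervalIntegral.integral_add hi1 hi2, h1, h2]
  simp [mul_comm]

namespace IsAxisymmetricPattern

variable {n : ℕ} {z : ℕ → ℝ} {u : S2 → ℝ} {m : ℝ}

lemma abs_stepFn_sub_le (n : ℕ) (z : ℕ → ℝ) (m s : ℝ) : |stepFn n z s - m| ≤ 1 + 2 * n + |m| :=
  abs_alternating_sum_le n (fun k => by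
    by_cases h : z k ≤ s <;> simp [Set.indicator, h]) m

lemma intervalIntegrable_stepFn_sub (a b : ℝ) :
    IntervalIntegrable (fun s => stepFn n z s - m) volume a b :=
  intervalIntegrable_of_abs_le ((measurable_stepFn n z).sub_const m) (abs_stepFn_sub_le n z m) _ _

lemma integral_stepFn_sub (hu : IsAxisymmetricPattern n z u)
    (hmass : 1 / (4 * Real.pi) * ∫ x : S2, u x ∂surfaceMeasure = m) :
    ∫ s in (-1 : ℝ)..1, (stepFn n z s - m) = 0 := by
  simp_rw [hu.eq_stepFn] at hmass
  rw [integral_height (measurable_stepFn n z)] at hmass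
  have h := intervalIntegrable_of_abs_le (measurable_stepFn n z)
    (fun s => by simpa using abs_stepFn_sub_le n z 0 s) (-1) 1
  rw [intervalIntegral.integral_sub h intervalIntegrable_const, intervalIntegral.integral_const,
    smul_eq_mul]
  have := Real.pi_pos
  field_simp at hmass
  linarith

lemma integral_stepFn_sub_piece (hu : IsAxisymmetricPattern n z u) {k : ℕ} (hk : k ≤ n) {s : ℝ}
    (hs : s ∈ Set.Icc (z k) (z (k + 1))) :
    ∫ r in (z k)..s, (stepFn n z r - m) = ((-1) ^ (k + 1) - m) * (s - z k) := by
  have h : ∀ᵐ r : ℝ, r ∈ Set.uIoc (z k) s → stepFn n z r - m = (-1) ^ (k + 1) - m := by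
    have : ∀ᵐ r : ℝ, r ≠ s := by simp [ae_iff, measure_singleton]
    filter_upwards [this] with r hrs hr
    rw [Set.uIoc_of_le hs.1] at hr
    rw [hu.stepFn_eq hk hr.1.le (Or.inl ((lt_of_le_of_ne hr.2 hrs).trans_le hs.2))]
  rw [intervalIntegral.integral_congr_ae h, intervalIntegral.integral_const, smul_eq_mul, mul_comm]

lemma integral_stepFn_sub_eq_xi (hu : IsAxisymmetricPattern n z u) {k : ℕ} (hk : k ≤ n + 1) :
    ∫ r in (-1 : ℝ)..(z k), (stepFn n z r - m) = xi m z k := by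
  induction k with
  | zero => simp [hu.first, xi]
  | succ k ih =>
    rw [← intervalIntegral.integral_add_adjacent_intervals (intervalIntegrable_stepFn_sub _ (z k))
      (intervalIntegrable_stepFn_sub _ _), ih (by omega),
      hu.integral_stepFn_sub_piece (by omega) ⟨(hu.lt k (by omega)).le, le_rfl⟩, xi_succ]

lemma xi_last (hu : IsAxisymmetricPattern n z u)
    (hmass : 1 / (4 * Real.pi) * ∫ x : S2, u x ∂surfaceMeasure = m) : xi m z (n + 1) = 0 := by
  rw [← hu.integral_stepFn_sub_eq_xi le_rfl, hu.last, hu.integral_stepFn_sub hmass]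

/-- The left side is the primitive of `u - m` evaluated at the north pole, where the mass condition
makes it vanish. -/
lemma xi_sub_last (hu : IsAxisymmetricPattern n z u)
    (hmass : 1 / (4 * Real.pi) * ∫ x : S2, u x ∂surfaceMeasure = m) :
    xi m z n - ((-1) ^ n + m) * (1 - z n) = 0 := by
  have h := hu.xi_last hmass
  rw [xi_succ, hu.last] at h
  linear_combination h

lemma isPoissonSolution (hu : IsAxisymmetricPattern n z u)
    (hmass : 1 / (4 * Real.pi) * ∫ x : S2, u x ∂surfaceMeasure = m) :
    IsPoissonSolution u m
      (fun x => ∫ s in (0 : ℝ)..((x : E3) 2), poissonSlope (fun s => stepFn n z s - m) s)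
      (fun x => heightField (poissonSlope fun s => stepFn n z s - m) x) :=
  isPoissonSolution_poissonSlope ((measurable_stepFn n z).sub_const m)
    (G := fun j s => rampFn n z j s - m) (fun j => (continuous_rampFn n z j).sub continuous_const)
    (fun j s => abs_rampFn_sub_le n z j s m) (fun s => (tendsto_rampFn n z s).sub_const m)
    (hu.integral_stepFn_sub hmass) fun x => by rw [hu.eq_stepFn]

lemma integral_norm_heightField_sq (hu : IsAxisymmetricPattern n z u)
    (hmass : 1 / (4 * Real.pi) * ∫ x : S2, u x ∂surfaceMeasure = m) :
    ∫ x : S2, ‖heightField (poissonSlope fun s => stepFn n z s - m) x‖ ^ 2 ∂surfaceMeasure =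
      Real.pi * (-4 * (1 - m ^ 2) +
        ∑ k ∈ range (n + 1), (xi m z k - ((-1) ^ k + m) * (1 - z k)) ^ 2
              * Real.log ((1 - z k) / (1 - z (k + 1))) +
        ∑ k ∈ range (n + 1), (xi m z k + ((-1) ^ k + m) * (1 + z k)) ^ 2
              * Real.log ((1 + z (k + 1)) / (1 + z k))) := by
  set w := poissonSlope fun s => stepFn n z s - m with hw
  have hwm : Measurable w :=
    measurable_poissonSlope ((measurable_stepFn n z).sub_const m) (abs_stepFn_sub_le n z m)
  have hpiece : ∀ k < n + 1, IntervalIntegrable (fun s => w s ^ 2 * (1 - s ^ 2)) volume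
      (z k) (z (k + 1)) ∧ ∫ s in (z k)..(z (k + 1)), w s ^ 2 * (1 - s ^ 2) =
      ((xi m z k - ((-1) ^ k + m) * (1 - z k)) ^ 2 * Real.log ((1 - z k) / (1 - z (k + 1))) +
        (xi m z k + ((-1) ^ k + m) * (1 + z k)) ^ 2 * Real.log ((1 + z (k + 1)) / (1 + z k))) / 2 -
        ((-1) ^ k + m) ^ 2 * (z (k + 1) - z k) := by
    intro k hk
    refine integral_sq_affine_div (hu.lt k (by omega)).le (hu.mem_Icc (by omega)).1
      (hu.mem_Icc (by omega)).2 ?_ ?_ fun s hs => ?_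
    · rcases (Nat.lt_succ_iff.1 hk).eq_or_lt with rfl | h
      · exact Or.inl (hu.xi_sub_last hmass)
      · exact Or.inr (hu.lt_one h)
    · rcases Nat.eq_zero_or_pos k with rfl | h
      · exact Or.inl (by simp [xi, hu.first])
      · exact Or.inr (hu.neg_one_lt h (by omega))
    · have h1 : s ∈ Set.Ioo (-1 : ℝ) 1 := ⟨(hu.mem_Icc (by omega)).1.trans_lt hs.1,
        hs.2.trans_le (hu.mem_Icc (by omega)).2⟩
      have h2 : 0 < 1 - s ^ 2 := by nlinarith [h1.1, h1.2]
      rw [hw, poissonSlope, Set.indicator_of_mem h1,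
        ← intervalIntegral.integral_add_adjacent_intervals (intervalIntegrable_stepFn_sub _ (z k))
          (intervalIntegrable_stepFn_sub _ _), hu.integral_stepFn_sub_eq_xi (by omega),
        hu.integral_stepFn_sub_piece (by omega) (Set.Ioo_subset_Icc_self hs)]
      field_simp
      ring
  -- Since `((-1)^k)² = 1`, the square is `(1 - m²) + 2m((-1)^k + m)`; the second part is a multiple
  -- of an increment of `xi`, which vanishes at both ends.
  have htel : ∑ k ∈ range (n + 1), ((-1) ^ k + m) ^ 2 * (z (k + 1) - z k) = 2 * (1 - m ^ 2) := by
    have h1 : ∀ k, ((-1) ^ k + m) ^ 2 * (z (k + 1) - z k) =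
        (1 - m ^ 2) * (z (k + 1) - z k) - 2 * m * (xi m z (k + 1) - xi m z k) := fun k => by
      have h2 : ((-1 : ℝ) ^ k) ^ 2 = 1 := by rw [← pow_mul, mul_comm, pow_mul]; norm_num
      rw [xi_succ]
      linear_combination (z (k + 1) - z k) * h2
    simp_rw [h1]
    rw [sum_sub_distrib, ← mul_sum, ← mul_sum, sum_range_sub, sum_range_sub, hu.xi_last hmass,
      hu.last, hu.first]
    simp [xi]
    ring
  have h1 : ∀ x : S2, ‖heightField w x‖ ^ 2 = w ((x : E3) 2) ^ 2 * (1 - (x : E3) 2 ^ 2) := fun x =>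
    norm_heightField_sq (norm_eq_of_mem_sphere x)
  simp_rw [h1]
  rw [integral_height (f := fun s => w s ^ 2 * (1 - s ^ 2)) (by fun_prop)]
  have h2 := intervalIntegral.sum_integral_adjacent_intervals fun k hk => (hpiece k hk).1
  rw [hu.first, hu.last] at h2
  rw [← h2, sum_congr rfl fun k hk => (hpiece k (Finset.mem_range.1 hk)).2, sum_sub_distrib, htel,
    ← sum_div, sum_add_distrib]
  ring

end IsAxisymmetricPattern

/-- All weak solutions of the Poisson problem have the same Dirichlet energy. -/
lemma IsPoissonSolution.integral_norm_sq_eq {u : S2 → ℝ} {m : ℝ} {v v' : S2 → ℝ} {g g' : S2 → E3}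
    (h : IsPoissonSolution u m v g) (h' : IsPoissonSolution u m v' g') :
    ∫ x : S2, ‖g x‖ ^ 2 ∂surfaceMeasure = ∫ x : S2, ‖g' x‖ ^ 2 ∂surfaceMeasure := by
  simp_rw [← real_inner_self_eq_norm_sq]
  -- Each solution is tested with itself and with the other; both energies become the mixed integral
  -- of `⟪g, g'⟫`.
  rw [h.weak v g h.grad, ← h'.weak v g h.grad, h'.weak v' g' h'.grad, ← h.weak v' g' h'.grad]
  simp_rw [real_inner_comm]

theorem proposition3p1 (γ : ℝ) (hγ : 0 < γ) (m : ℝ) (hm : m ∈ Set.Ioo (-1 : ℝ) 1)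
    (n : ℕ) (z : ℕ → ℝ) (u : S2 → ℝ) (hu : IsAxisymmetricPattern n z u)
    (hmass : 1 / (4 * Real.pi) * ∫ x : S2, u x ∂surfaceMeasure = m) :
    MemBVSign u ∧
    (∃ (v : S2 → ℝ) (g : S2 → E3), IsPoissonSolution u m v g) ∧
    -- the prefactors of the two infinite logarithms below vanish
    xi m z 0 + ((-1) ^ 0 + m) * (1 + z 0) = 0 ∧
    xi m z n - ((-1) ^ n + m) * (1 - z n) = 0 ∧
    ∀ (v : S2 → ℝ) (g : S2 → E3), IsPoissonSolution u m v g →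
      1 / Real.pi * energy γ u g =
        -4 * γ * (1 - m ^ 2) + 2 * ∑ k ∈ Icc 1 n, √(1 - z k ^ 2)
        + γ * ∑ k ∈ range (n + 1),
            (xi m z k - ((-1) ^ k + m) * (1 - z k)) ^ 2
              * Real.log ((1 - z k) / (1 - z (k + 1)))
        + γ * ∑ k ∈ range (n + 1),
            (xi m z k + ((-1) ^ k + m) * (1 + z k)) ^ 2
              * Real.log ((1 + z (k + 1)) / (1 + z k))
      ∧ (m = 0 →
        1 / Real.pi * energy γ u g =
          -4 * γ + 2 * ∑ k ∈ Icc 1 n, √(1 - z k ^ 2)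
          + γ * ∑ k ∈ range (n + 1),
              (xi 0 z k - (-1) ^ k * (1 - z k)) ^ 2
                * Real.log ((1 - z k) / (1 - z (k + 1)))
          + γ * ∑ k ∈ range (n + 1),
              (xi 0 z k + (-1) ^ k * (1 + z k)) ^ 2
                * Real.log ((1 + z (k + 1)) / (1 + z k))) 
:= by
  have hgen : ∀ (v : S2 → ℝ) (g : S2 → E3), IsPoissonSolution u m v g →
      1 / Real.pi * energy γ u g =
        -4 * γ * (1 - m ^ 2) + 2 * ∑ k ∈ Icc 1 n, √(1 - z k ^ 2)
        + γ * ∑ k ∈ range (n + 1),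
            (xi m z k - ((-1) ^ k + m) * (1 - z k)) ^ 2
              * Real.log ((1 - z k) / (1 - z (k + 1)))
        + γ * ∑ k ∈ range (n + 1),
            (xi m z k + ((-1) ^ k + m) * (1 + z k)) ^ 2
              * Real.log ((1 + z (k + 1)) / (1 + z k)) := fun v g hv => by
    rw [energy, hv.integral_norm_sq_eq (hu.isPoissonSolution hmass),
      hu.integral_norm_heightField_sq hmass, hu.totalVariation_eq, ENNReal.toReal_ofReal
        (mul_nonneg (by positivity) (sum_nonneg fun _ _ => Real.sqrt_nonneg _))]
    have := Real.pi_ne_zero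
    field_simp
    ring
  refine ⟨hu.memBVSign, ⟨_, _, hu.isPoissonSolution hmass⟩, by simp [hu.first, xi],
    hu.xi_sub_last hmass, fun v g hv => ⟨hgen v g hv, fun hm0 => ?_⟩⟩
  rw [hgen v g hv, hm0]
  simp only [add_zero]
  ring
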